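/- Let $\theta = 2\cos(2\pi/15)$, $K=\mathbb{Q}(i,\theta)$, $F=\mathbb{Q}(\theta)$, $L=\mathbb{Q}(i)$. Then $K/L$ is Galois with cyclic Galois group of order $4$, and $K/F$ is Galois with (cyclic) Galois group of order $2$. Let $\tau$ be any generator of $\mathrm{Gal}(K/L)$ and $\sigma$ the generator of $\mathrm{Gal}(K/F)$. Let $\mathcal{A}=(K/F,\sigma,-1)=K\oplus \mathbf{j}K$ be the cyclic algebra with $a\,\mathbf{j}=\mathbf{j}\,\sigma(a)$ for $a\in K$ and $\mathbf{j}^2=-1$, and put $\Upsilon(a+\mathbf{j}b)=\tau(a)+\mathbf{j}\tau(b)$ for $a,b\in K$. Then: 1. $A\,\Upsilon(A)\,\Upsilon^2(A)\,\Upsilon^3(A)\neq i$ for every $A\in\mathcal{A}$. Put $\alpha=1-3i+i\theta^2$, $\theta_1=\alpha$, $\theta_2=\alpha\theta$, $\theta_3=\alpha\theta(-3+\theta^2)$, $\theta_4=\alpha(-1-3\theta+\theta^2+\theta^3)$. For a symbol vector $s=(s_{kj})_{k=0,1;\,1\le j\le 8}$ with $s_{kj}\in\mathbb{Z}[i]$,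 let $$\mathbf{A}_k=\begin{bmatrix}\sum_{j=1}^4 s_{kj}\theta_j & -\sigma\big(\sum_{j=1}^4 s_{k(j+4)}\theta_j\big)\\ \sum_{j=1}^4 s_{k(j+4)}\theta_j & \sigma\big(\sum_{j=1}^4 s_{kj}\theta_j\big)\end{bmatrix},\qquad \mathbf{S}(s)=\begin{bmatrix}\mathbf{A}_0&\mathbf{O}&\mathbf{O}&i\Upsilon^3(\mathbf{A}_1)\\ \mathbf{A}_1&\Upsilon(\mathbf{A}_0)&\mathbf{O}&\mathbf{O}\\ \mathbf{O}&\Upsilon(\mathbf{A}_1)&\Upsilon^2(\mathbf{A}_0)&\mathbf{O}\\ \mathbf{O}&\mathbf{O}&\Upsilon^2(\mathbf{A}_1)&\Upsilon^3(\mathbf{A}_0)\end{bmatrix}\in\mathbb{C}^{8\times 8},$$ where $\Upsilon^l$ applies $\tau^l$ to every entry of a matrix. Then: 2. (Full diversity) For every $M=2^a$ with $a$ even and positive, and any two distinct symbol vectors $s\ne t$ with all entries in $M$-QAM, i.e. in the set of $x+iy$ with $x,y\in\{-\sqrt M+1,-\sqrt M+3,\dots,\sqrt M-1\}$, one has $\det(\mathbf{S}(s)-\mathbf{S}(t))\neq0$.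 3. (Non-vanishing determinant) $\inf\{|\det \mathbf{S}(s)|^2 : s_{kj}\in\mathbb{Z}[i],\ \mathbf{S}(s)\neq \mathbf{O}\}>0$. -/

import Mathlib

open scoped IntermediateField

/-! ### Cyclic algebras of degree two -/

/-- The underlying space of the cyclic algebra `(K/F, σ, γ) = K ⊕ jK` of degree two; the element
`⟨a, b⟩` stands for `a + j b`. -/
@[ext]
structure CyclicAlgebra {F K : Type*} [Field F] [Field K] [Algebra F K]
    (σ : K ≃ₐ[F] K) (γ : F) where
  fst : K
  snd : K

namespace CyclicAlgebra

variable {F K : Type*} [Field F] [Field K] [Algebra F K] {σ : K ≃ₐ[F] K} {γ : F}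

instance : Zero (CyclicAlgebra σ γ) := ⟨⟨0, 0⟩⟩
instance : One (CyclicAlgebra σ γ) := ⟨⟨1, 0⟩⟩
instance : Add (CyclicAlgebra σ γ) := ⟨fun A B => ⟨A.fst + B.fst, A.snd + B.snd⟩⟩
instance : Neg (CyclicAlgebra σ γ) := ⟨fun A => ⟨-A.fst, -A.snd⟩⟩

/-- The product determined by `a j = j σ(a)` and `j² = γ`. -/
instance : Mul (CyclicAlgebra σ γ) :=
  ⟨fun A B => ⟨A.fst * B.fst + algebraMap F K γ * (σ A.snd * B.snd),
    σ A.fst * B.snd + A.snd * B.fst⟩⟩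

@[simp] theorem zero_fst : (0 : CyclicAlgebra σ γ).fst = 0 := rfl
@[simp] theorem zero_snd : (0 : CyclicAlgebra σ γ).snd = 0 := rfl
@[simp] theorem one_fst : (1 : CyclicAlgebra σ γ).fst = 1 := rfl
@[simp] theorem one_snd : (1 : CyclicAlgebra σ γ).snd = 0 := rfl
@[simp] theorem add_fst (A B : CyclicAlgebra σ γ) : (A + B).fst = A.fst + B.fst := rfl
@[simp] theorem add_snd (A B : CyclicAlgebra σ γ) : (A + B).snd = A.snd + B.snd := rfl
@[simp] theorem neg_fst (A : CyclicAlgebra σ γ) : (-A).fst = -A.fst := rfl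
@[simp] theorem neg_snd (A : CyclicAlgebra σ γ) : (-A).snd = -A.snd := rfl
@[simp] theorem mul_fst (A B : CyclicAlgebra σ γ) :
    (A * B).fst = A.fst * B.fst + algebraMap F K γ * (σ A.snd * B.snd) := rfl
@[simp] theorem mul_snd (A B : CyclicAlgebra σ γ) :
    (A * B).snd = σ A.fst * B.snd + A.snd * B.fst := rfl

/-- When `σ² = 1`, the cyclic algebra is an associative ring with one. -/
instance instRing [hσ : Fact (∀ x, σ (σ x) = x)] : Ring (CyclicAlgebra σ γ) where
  add_assoc A B C := by ext <;> simp [add_assoc]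
  zero_add A := by ext <;> simp
  add_zero A := by ext <;> simp
  add_comm A B := by ext <;> simp [add_comm]
  neg_add_cancel A := by ext <;> simp
  one_mul A := by ext <;> simp
  mul_one A := by ext <;> simp
  zero_mul A := by ext <;> simp
  mul_zero A := by ext <;> simp
  left_distrib A B C := by ext <;> simp <;> ring
  right_distrib A B C := by ext <;> simp <;> ring
  mul_assoc A B C := by ext <;> simp [hσ.out] <;> ring
  nsmul := nsmulRec
  zsmul := zsmulRec

/-- The embedding of `K` into `K ⊕ jK`. -/
def ofField (a : K) : CyclicAlgebra σ γ := ⟨a, 0⟩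

/-- The map `Υ (a + j b) = τ(a) + j τ(b)`. -/
def upsilon {L : Type*} [Field L] [Algebra L K] (τ : K ≃ₐ[L] K) (A : CyclicAlgebra σ γ) :
    CyclicAlgebra σ γ :=
  ⟨τ A.fst, τ A.snd⟩

/-- The matrix of left multiplication by `A` on the right `K`-vector space `K ⊕ jK`
in the basis `1, j`. -/
def toMatrix (A : CyclicAlgebra σ γ) : Matrix (Fin 2) (Fin 2) K :=
  !![A.fst, algebraMap F K γ * σ A.snd;
     A.snd, σ A.fst]

end CyclicAlgebra

/-! ### The number fields -/

namespace MIDO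

noncomputable section

/-- `2 cos (2π/15) = ζ₁₅ + ζ₁₅⁻¹`, as a complex number. -/
def thetaC : ℂ := ((2 * Real.cos (2 * Real.pi / 15) : ℝ) : ℂ)

/-- `K = ℚ(i, θ)`. -/
def K : IntermediateField ℚ ℂ := IntermediateField.adjoin ℚ {Complex.I, thetaC}

/-- `i` as an element of `K`. -/
def iK : K := ⟨Complex.I, IntermediateField.subset_adjoin _ _ (by simp)⟩

/-- `θ` as an element of `K`. -/
def thetaK : K := ⟨thetaC, IntermediateField.subset_adjoin _ _ (by simp)⟩

/-- `F = ℚ(θ)`, as a subfield of `K`. -/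
def F : IntermediateField ℚ K := ℚ⟮thetaK⟯

/-- `L = ℚ(i)`, as a subfield of `K`. -/
def L : IntermediateField ℚ K := ℚ⟮iK⟯

/-! ### The `8 × 2` code -/

/-- The PAM constellation with `N` points, `{-N+1, -N+3, …, N-1}`. -/
def PAM (N : ℕ) : Set ℤ := {x | ∃ k : ℕ, k < N ∧ x = -(N : ℤ) + 1 + 2 * k}

/-- `M`-QAM, where `M` is a perfect square. -/
def QAM (M : ℕ) : Set GaussianInt := {z | z.re ∈ PAM (Nat.sqrt M) ∧ z.im ∈ PAM (Nat.sqrt M)}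

/-- A Gaussian integer as an element of `K`. -/
def gaussToK (z : GaussianInt) : K := (z.re : K) + (z.im : K) * iK

/-- `α = 1 - 3 i + i θ²`. -/
def alpha : K := 1 - 3 * iK + iK * thetaK ^ 2

/-- The elements `θ₁, θ₂, θ₃, θ₄` of the ring of integers of `K`. -/
def thetaBasis : Fin 4 → K :=
  ![alpha, alpha * thetaK, alpha * thetaK * (-3 + thetaK ^ 2),
    alpha * (-1 - 3 * thetaK + thetaK ^ 2 + thetaK ^ 3)]

/-- The element `A_k = ∑ᵢ s_{k,i} θᵢ + j ∑ᵢ s_{k,i+4} θᵢ` of the cyclic algebra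
`(K/F, σ, -1)`. -/
def layer (σ : K ≃ₐ[F] K) (s : Fin 2 × Fin 8 → GaussianInt) (k : Fin 2) :
    CyclicAlgebra σ (-1 : F) :=
  ⟨∑ i : Fin 4, gaussToK (s (k, Fin.castAdd 4 i)) * thetaBasis i,
    ∑ i : Fin 4, gaussToK (s (k, Fin.natAdd 4 i)) * thetaBasis i⟩

/-- The codeword matrix, with entries in `K`, as a `4 × 4` matrix of `2 × 2` blocks; `U l B`
applies `τ^l` to every entry of the block `B`. -/
def codewordK (σ : K ≃ₐ[F] K) (τ : K ≃ₐ[L] K) (s : Fin 2 × Fin 8 → GaussianInt) :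
    Matrix (Fin 4 × Fin 2) (Fin 4 × Fin 2) K :=
  let A₀ := (layer σ s 0).toMatrix
  let A₁ := (layer σ s 1).toMatrix
  let U : ℕ → Matrix (Fin 2) (Fin 2) K → Matrix (Fin 2) (Fin 2) K :=
    fun l B => B.map (τ ^ l : K ≃ₐ[L] K)
  Matrix.comp (Fin 4) (Fin 4) (Fin 2) (Fin 2) K
    !![A₀, 0, 0, iK • U 3 A₁;
       A₁, U 1 A₀, 0, 0;
       0, U 1 A₁, U 2 A₀, 0;
       0, 0, U 2 A₁, U 3 A₀]

/-- The (unnormalized) complex codeword matrix of the `8 × 2` code carrying the symbols `s`. -/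
def codeword (σ : K ≃ₐ[F] K) (τ : K ≃ₐ[L] K) (s : Fin 2 × Fin 8 → GaussianInt) :
    Matrix (Fin 4 × Fin 2) (Fin 4 × Fin 2) ℂ :=
  (codewordK σ τ s).map (fun x : K => (x : ℂ))

/-- Full diversity of the code that encodes symbols from the constellation `C` by `X`: codeword
matrices of distinct symbol vectors have a nonsingular difference. -/
def FullDiversity {κ n : Type*} [Fintype n] [DecidableEq n]
    (X : (κ → GaussianInt) → Matrix n n ℂ) (C : Set GaussianInt) : Prop :=
  ∀ s t : κ → GaussianInt, (∀ j, s j ∈ C) → (∀ j, t j ∈ C) → s ≠ t → (X s - X t).det ≠ 0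

/-- Non-vanishing determinant: over all symbol vectors from the lattice `ℤ[i]`, the infimum of
`|det|²` over the nonzero codeword matrices is positive. -/
def NVD {κ n : Type*} [Fintype n] [DecidableEq n]
    (X : (κ → GaussianInt) → Matrix n n ℂ) : Prop :=
  0 < sInf {d : ℝ | ∃ s : κ → GaussianInt, X s ≠ 0 ∧ d = ‖(X s).det‖ ^ 2}

end

end MIDO

/-!
The field `K = ℚ(i, θ)` is cyclic of degree four over `L = ℚ(i)` because the minimal polynomial
`X⁴ - X³ - 4X² + 4X + 1` of `θ`, which is Eisenstein at `5` after the substitution `X ↦ X - 1`,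
splits over `ℚ(θ)`, its roots being permuted by `x ↦ x² - 2`. The generator `σ` of `Gal(K/F)` is
complex conjugation, so the cyclic algebra `K ⊕ jK` is the algebra of Hamilton quaternions over
the real field `F`. It is a division algebra, as its reduced norm is a sum of two squares of
absolute values.

The arithmetic input is that `i` is not a norm from `K` to `L` (`norm_ne_iK`). A prime `P` of `K`
above `5` is totally and tamely ramified over `L` with residue field `𝔽₅` and uniformizer `θ + 1`.
The Galois group acts trivially on residues, so a unit at `P` has a norm that is a fourth power,
hence `1`, in `𝔽₅`, whereas `i` reduces to `2` or `-2`. To avoid ramification theory the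
argument runs in the order `ℤ[i, θ]`, where every nonzero element is, up to elements outside `P`,
a power of `θ + 1` (`exists_eq_pow_mul`).

If `A Υ(A) Υ²(A) Υ³(A) = i`, applying `Υ` shows that `A` commutes with `i`. Hence `A ∈ K` and `i`
is its norm, which is impossible (`mul_upsilonHom_ne_iK`). As the square roots of `-1` in the
quaternion algebra are the conjugates of `i`, the product is not a square root of `-1` either
(`mul_upsilonHom_sq_ne_neg_one`).

For the determinant, elimination in a kernel vector of the codeword with layers `A₀ ≠ 0` and `A₁`
gives an eigenvector for `-i` of the matrix of `Υ³(C) Υ²(C) Υ(C) C` with `C = A₁ A₀⁻¹`. The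
characteristic polynomial of this quaternion is real, so it is `X² + 1` and the quaternion squares
to `-1`, a contradiction (`det_blockMatrix_ne_zero`). Full diversity follows because codewords
depend additively on the symbols and `θ₁, …, θ₄` are independent over `L`. Finally, conjugation by
a monomial matrix shows that the determinant is fixed by `τ` (`galL_det_blockMatrix`). Being
integral, it is a Gaussian integer, and a nonzero one has absolute value at least one.
-/

namespace MIDO

open Polynomial IntermediateField

/-! ### The element `θ` and the generators of `K` -/

theorem iK_sq : iK ^ 2 = -1 := by
  apply Subtype.ext
  simp [iK]

/-- The minimal equation of `θ`, read off from the fifteenth cyclotomic polynomial at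
`ζ₁₅ = exp (2πi/15)`. -/
theorem thetaC_eq : thetaC ^ 4 - thetaC ^ 3 - 4 * thetaC ^ 2 + 4 * thetaC + 1 = 0 := by
  have hz := Complex.isPrimitiveRoot_exp 15 (by norm_num)
  set z := Complex.exp (2 * Real.pi * Complex.I / (15 : ℕ)) with hzdef
  have hz0 : z ≠ 0 := Complex.exp_ne_zero _
  have hth : thetaC = z + z⁻¹ := by
    rw [thetaC, hzdef, ← Complex.exp_neg]
    push_cast
    rw [Complex.two_cos]
    congr 2 <;> ring
  have h15 : z ^ 15 = 1 := hz.pow_eq_one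
  have h5 : z ^ 5 - 1 ≠ 0 := sub_ne_zero.2 (hz.pow_ne_one_of_pos_of_lt (by norm_num) (by norm_num))
  have h3 : z ^ 3 - 1 ≠ 0 := sub_ne_zero.2 (hz.pow_ne_one_of_pos_of_lt (by norm_num) (by norm_num))
  have h1 : z ^ 10 + z ^ 5 + 1 = 0 := by
    apply mul_left_cancel₀ h5
    linear_combination h15
  have h2 : z ^ 8 - z ^ 7 + z ^ 5 - z ^ 4 + z ^ 3 - z + 1 = 0 := by
    apply mul_left_cancel₀ h3
    linear_combination (z - 1) * h1
  rw [hth]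
  field_simp
  linear_combination h2

theorem thetaK_eq : thetaK ^ 4 - thetaK ^ 3 - 4 * thetaK ^ 2 + 4 * thetaK + 1 = 0 := by
  have h : algebraMap K ℂ thetaK = thetaC := rfl
  apply (algebraMap K ℂ).injective
  simpa only [h, map_sub, map_add, map_mul, map_pow, map_ofNat, map_one, map_zero] using thetaC_eq

/-- The minimal polynomial of `θ` splits over `ℚ(θ)`: its other roots are obtained from `θ` by
iterating `x ↦ x² - 2`. -/
theorem eq_root_of_eq_zero {x : K} (hx : x ^ 4 - x ^ 3 - 4 * x ^ 2 + 4 * x + 1 = 0) :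
    x = thetaK ∨ x = thetaK ^ 2 - 2 ∨ x = thetaK ^ 3 - 4 * thetaK + 1 ∨
      x = -thetaK ^ 3 - thetaK ^ 2 + 3 * thetaK + 2 := by
  have h : (x - thetaK) * (x - (thetaK ^ 2 - 2)) * (x - (thetaK ^ 3 - 4 * thetaK + 1)) *
      (x - (-thetaK ^ 3 - thetaK ^ 2 + 3 * thetaK + 2)) = 0 := by
    linear_combination hx + ((-1 + 6 * thetaK ^ 2 + 3 * thetaK ^ 3 - 2 * thetaK ^ 4 - thetaK ^ 5) +
      x * (-6 * thetaK - thetaK ^ 2 + 3 * thetaK ^ 3 + thetaK ^ 4) +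
      x ^ 2 * (-2 * thetaK - thetaK ^ 2)) * thetaK_eq
  simpa [sub_eq_zero, or_assoc] using h

/-- Induction for `K` as the field generated by `i` and `θ`. -/
theorem K_induction {p : K → Prop} (hi : p iK) (ht : p thetaK)
    (hq : ∀ q : ℚ, p (algebraMap ℚ K q)) (hadd : ∀ x y, p x → p y → p (x + y))
    (hinv : ∀ x, p x → p x⁻¹) (hmul : ∀ x y, p x → p y → p (x * y)) (x : K) : p x := by
  obtain ⟨x, hx⟩ := x
  refine IntermediateField.adjoin_induction (F := ℚ) (s := {Complex.I, thetaC})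
    (p := fun x hx => p ⟨x, hx⟩) ?_ ?_ ?_ ?_ ?_ hx
  · rintro x (rfl | rfl)
    exacts [hi, ht]
  · exact hq
  · exact fun x y hx hy => hadd _ _
  · exact fun x hx => hinv _
  · exact fun x y hx hy => hmul _ _

theorem ringHom_ext {E : Type*} [Field E] {f g : K →+* E} (hi : f iK = g iK)
    (ht : f thetaK = g thetaK) (x : K) : f x = g x := by
  induction x using K_induction with
  | hi => exact hi
  | ht => exact ht
  | hq q => simp
  | hadd x y hx hy => simp [hx, hy]
  | hinv x hx => simp [hx]
  | hmul x y hx hy => simp [hx, hy]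

theorem isIntegral_iK : IsIntegral ℤ iK :=
  ⟨X ^ 2 + 1, by monicity!, by simp [iK_sq]⟩

theorem isIntegral_of_eq {x : K} (hx : x ^ 4 - x ^ 3 - 4 * x ^ 2 + 4 * x + 1 = 0) :
    IsIntegral ℤ x :=
  ⟨X ^ 4 - X ^ 3 - 4 * X ^ 2 + 4 * X + 1, by monicity!, by simpa using hx⟩

theorem isIntegral_thetaK : IsIntegral ℤ thetaK := isIntegral_of_eq thetaK_eq

instance : FiniteDimensional ℚ K := by
  apply IntermediateField.finiteDimensional_adjoin
  rintro x (rfl | rfl)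
  · exact (Complex.isIntegral_int_I).tower_top
  · exact ⟨X ^ 4 - X ^ 3 - 4 * X ^ 2 + 4 * X + 1, by monicity!, by simpa using thetaC_eq⟩

instance : NumberField K where

theorem star_thetaK : (starRingEnd ℂ) (thetaK : ℂ) = thetaK := by
  exact Complex.conj_ofReal _

theorem coe_iK : (iK : ℂ) = Complex.I := rfl

/-- `F` is a real field. -/
theorem star_of_mem_F {x : K} (hx : x ∈ F) : (starRingEnd ℂ) (x : ℂ) = x := by
  induction hx using IntermediateField.adjoin_induction with
  | mem x hx =>
    obtain rfl : x = thetaK := hx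
    exact star_thetaK
  | algebraMap q => simp
  | add x y hx hy h1 h2 => simp [h1, h2]
  | inv x hx h1 => simp [h1]
  | mul x y hx hy h1 h2 => simp [h1, h2]

theorem iK_notMem_F : iK ∉ F := fun h => by
  have := star_of_mem_F h
  rw [coe_iK, Complex.conj_I] at this
  have h2 := congrArg Complex.im this
  norm_num at h2

/-! ### Degrees and Galois groups -/

/-- The element `θ + 1` is a root of a polynomial that is Eisenstein at `5`. -/
theorem finrank_F : Module.finrank ℚ F = 4 := by
  let g : ℤ[X] := X ^ 4 - 5 * X ^ 3 + 5 * X ^ 2 + 5 * X - 5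
  have hdeg : g.natDegree = 4 := by simp only [g]; compute_degree!
  have hm : g.Monic := by simp only [g]; monicity!
  have hp : (Ideal.span {(5 : ℤ)}).IsPrime := by
    rw [Ideal.span_singleton_prime (by norm_num)]; norm_num
  have hcoeff : ∀ n, g.coeff n = if n = 0 then -5 else if n = 1 then 5 else if n = 2 then 5
      else if n = 3 then -5 else if n = 4 then 1 else 0 := by
    intro n
    have : g = X ^ 4 - C 5 * X ^ 3 + C 5 * X ^ 2 + C 5 * X - C 5 := by simp [g]
    rw [this]
    simp only [coeff_sub, coeff_add, coeff_C_mul, coeff_X_pow, coeff_X, coeff_C]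
    split_ifs <;> omega
  have hirr : Irreducible g := by
    apply IsEisensteinAt.irreducible (𝓟 := Ideal.span {(5 : ℤ)}) _ hp hm.isPrimitive (by omega)
    refine ⟨?_, ?_, ?_⟩
    · rw [hm.leadingCoeff, Ideal.mem_span_singleton]; norm_num
    · intro n hn
      rw [hdeg] at hn
      rw [hcoeff, Ideal.mem_span_singleton]
      interval_cases n <;> norm_num
    · rw [hcoeff, Ideal.span_singleton_pow, Ideal.mem_span_singleton]; norm_num
  have hQ : Irreducible (g.map (algebraMap ℤ ℚ)) :=
    (hm.irreducible_iff_irreducible_map_fraction_map).1 hirr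
  have hroot : aeval (thetaK + 1) (g.map (algebraMap ℤ ℚ)) = 0 := by
    simp only [aeval_map_algebraMap, g]
    simp only [map_sub, map_add, map_mul, map_pow, aeval_X, map_ofNat]
    linear_combination thetaK_eq
  have hmin := minpoly.eq_of_irreducible_of_monic hQ hroot (hm.map _)
  have hF : F = ℚ⟮thetaK + 1⟯ := by
    apply le_antisymm
    · rw [F, adjoin_simple_le_iff]
      simpa using sub_mem (mem_adjoin_simple_self ℚ (thetaK + 1)) (one_mem _)
    · rw [adjoin_simple_le_iff]
      exact add_mem (mem_adjoin_simple_self ℚ thetaK) (one_mem _)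
  rw [hF, IntermediateField.adjoin.finrank (Algebra.IsIntegral.isIntegral _), ← hmin,
    natDegree_map_eq_of_injective (RingHom.injective_int _), hdeg]

/-- Adjoining `i` to a field without it gives a quadratic extension. -/
theorem finrank_adjoin_iK {k : Type*} [Field k] [Algebra k K]
    (h : iK ∉ Set.range (algebraMap k K)) : Module.finrank k k⟮iK⟯ = 2 := by
  have hdeg : (X ^ 2 + 1 : k[X]).natDegree = 2 := by compute_degree!
  have hm : (X ^ 2 + 1 : k[X]).Monic := by monicity!
  have hroot : aeval iK (X ^ 2 + 1 : k[X]) = 0 := by simp [iK_sq]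
  have hirr : Irreducible (X ^ 2 + 1 : k[X]) := by
    refine irreducible_of_degree_le_three_of_not_isRoot (by rw [hdeg]; decide) fun x hx => h ?_
    have hx' : x ^ 2 + 1 = 0 := by simpa using hx
    have h2 : (algebraMap k K x - iK) * (algebraMap k K x + iK) = 0 := by
      have := congrArg (algebraMap k K) hx'
      simp only [map_add, map_pow, map_one, map_zero] at this
      linear_combination this - iK_sq
    rcases mul_eq_zero.1 h2 with h2 | h2
    · exact ⟨x, sub_eq_zero.1 h2⟩
    · exact ⟨-x, by rw [map_neg]; linear_combination -h2⟩
  rw [IntermediateField.adjoin.finrank ⟨_, hm, hroot⟩,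
    ← minpoly.eq_of_irreducible_of_monic hirr hroot hm, hdeg]

theorem finrank_L : Module.finrank ℚ L = 2 := by
  refine finrank_adjoin_iK ?_
  rintro ⟨x, hx⟩
  exact iK_notMem_F (hx ▸ F.algebraMap_mem x)

theorem adjoin_F_iK : F⟮iK⟯ = ⊤ := by
  rw [eq_top_iff]
  rintro x -
  induction x using K_induction with
  | hi => exact mem_adjoin_simple_self F iK
  | ht => exact F⟮iK⟯.algebraMap_mem ⟨thetaK, mem_adjoin_simple_self ℚ thetaK⟩
  | hq q => exact F⟮iK⟯.algebraMap_mem (algebraMap ℚ F q)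
  | hadd x y hx hy => exact add_mem hx hy
  | hinv x hx => exact inv_mem hx
  | hmul x y hx hy => exact mul_mem hx hy

theorem adjoin_L_thetaK : L⟮thetaK⟯ = ⊤ := by
  rw [eq_top_iff]
  rintro x -
  induction x using K_induction with
  | hi => exact L⟮thetaK⟯.algebraMap_mem ⟨iK, mem_adjoin_simple_self ℚ iK⟩
  | ht => exact mem_adjoin_simple_self L thetaK
  | hq q => exact L⟮thetaK⟯.algebraMap_mem (algebraMap ℚ L q)
  | hadd x y hx hy => exact add_mem hx hy
  | hinv x hx => exact inv_mem hx
  | hmul x y hx hy => exact mul_mem hx hy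

theorem finrank_F_K : Module.finrank F K = 2 := by
  rw [← IntermediateField.finrank_top', ← adjoin_F_iK]
  refine finrank_adjoin_iK ?_
  rintro ⟨x, hx⟩
  exact iK_notMem_F (hx ▸ x.2)

theorem finrank_L_K : Module.finrank L K = 4 := by
  have h1 := Module.finrank_mul_finrank ℚ F K
  have h2 := Module.finrank_mul_finrank ℚ L K
  rw [finrank_F, finrank_F_K] at h1
  rw [finrank_L] at h2
  omega

instance : FiniteDimensional L K := Module.finite_of_finrank_pos (by rw [finrank_L_K]; norm_num)
instance : FiniteDimensional F K := Module.finite_of_finrank_pos (by rw [finrank_F_K]; norm_num)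

theorem galL_ext {τ τ' : K ≃ₐ[L] K} (h : τ thetaK = τ' thetaK) : τ = τ' := by
  ext1 x
  refine ringHom_ext (f := (τ : K →+* K)) (g := (τ' : K →+* K)) ?_ h x
  have := fun t : K ≃ₐ[L] K => t.commutes ⟨iK, mem_adjoin_simple_self ℚ iK⟩
  exact (this τ).trans (this τ').symm

theorem galL_iK (τ : K ≃ₐ[L] K) : τ iK = iK := τ.commutes ⟨iK, mem_adjoin_simple_self ℚ iK⟩

theorem minpoly_L_thetaK : minpoly L thetaK = X ^ 4 - X ^ 3 - 4 * X ^ 2 + 4 * X + 1 := by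
  have hint : IsIntegral L thetaK := Algebra.IsIntegral.isIntegral _
  have hm : (X ^ 4 - X ^ 3 - 4 * X ^ 2 + 4 * X + 1 : L[X]).Monic := by monicity!
  symm
  refine eq_of_monic_of_dvd_of_natDegree_le (minpoly.monic hint) hm
    (minpoly.dvd _ _ (by simpa [map_ofNat] using thetaK_eq)) ?_
  rw [← IntermediateField.adjoin.finrank hint, adjoin_L_thetaK, IntermediateField.finrank_top',
    finrank_L_K]
  compute_degree

theorem exists_galL_thetaK : ∃ τ : K ≃ₐ[L] K, τ thetaK = thetaK ^ 2 - 2 := by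
  let φ : L⟮thetaK⟯ →ₐ[L] K :=
    (IntermediateField.algHomAdjoinIntegralEquiv L (Algebra.IsIntegral.isIntegral thetaK)).symm
      ⟨thetaK ^ 2 - 2, by
        rw [mem_aroots, minpoly_L_thetaK]
        refine ⟨(by monicity! : Monic _).ne_zero, ?_⟩
        simp only [map_sub, map_add, map_mul, map_pow, aeval_X, map_ofNat, map_one]
        linear_combination
          (1 - 4 * thetaK - 4 * thetaK ^ 2 + thetaK ^ 3 + thetaK ^ 4) * thetaK_eq⟩
  let ψ : K →ₐ[L] K :=
    φ.comp (((equivOfEq adjoin_L_thetaK).trans topEquiv).symm : K →ₐ[L] L⟮thetaK⟯)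
  refine ⟨AlgEquiv.ofBijective ψ ψ.bijective, ?_⟩
  have : (((equivOfEq adjoin_L_thetaK).trans topEquiv).symm : K ≃ₐ[L] L⟮thetaK⟯) thetaK =
      AdjoinSimple.gen L thetaK := rfl
  change φ (((equivOfEq adjoin_L_thetaK).trans topEquiv).symm thetaK) = _
  rw [this]
  exact algHomAdjoinIntegralEquiv_symm_apply_gen L _ _

/-- The automorphism `θ ↦ θ² - 2` has order four: its square moves `θ`, since otherwise
the real number `θ` would satisfy `(θ - 1)² = -1`. -/
theorem orderOf_galL {τ : K ≃ₐ[L] K} (h : τ thetaK = thetaK ^ 2 - 2) : orderOf τ = 4 := by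
  have h2 : (τ ^ 2) thetaK = thetaK ^ 3 - 4 * thetaK + 1 := by
    rw [pow_two, AlgEquiv.mul_apply, h, map_sub, map_pow, h, map_ofNat]
    linear_combination thetaK_eq
  have h4 : (τ ^ 4) thetaK = thetaK := by
    rw [show 4 = 2 + 2 from rfl, pow_add, AlgEquiv.mul_apply, h2]
    simp only [map_sub, map_add, map_mul, map_pow, h2, map_ofNat, map_one]
    linear_combination (-2 + 11 * thetaK - 4 * thetaK ^ 2 - 7 * thetaK ^ 3 + thetaK ^ 4 +
      thetaK ^ 5) * thetaK_eq
  refine orderOf_eq_prime_pow (p := 2) (n := 1) ?_ (galL_ext h4)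
  intro h1
  rw [pow_one] at h1
  rw [h1, AlgEquiv.one_apply] at h2
  have h3 : (thetaK - 1) ^ 2 + 1 = 0 := by
    linear_combination thetaK_eq + (thetaK - 1) * h2
  have h4 := congrArg K.val h3
  simp only [map_add, map_pow, map_sub, map_one, map_zero] at h4
  have h5 : (((2 * Real.cos (2 * Real.pi / 15) - 1) ^ 2 + 1 : ℝ) : ℂ) = 0 := by
    rw [← h4, show K.val thetaK = ((2 * Real.cos (2 * Real.pi / 15) : ℝ) : ℂ) from rfl]
    push_cast
    rfl
  have h6 := Complex.ofReal_eq_zero.1 h5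
  nlinarith [sq_nonneg (2 * Real.cos (2 * Real.pi / 15) - 1)]

theorem card_galL : Nat.card (K ≃ₐ[L] K) = 4 := by
  obtain ⟨τ, h⟩ := exists_galL_thetaK
  apply le_antisymm
  · rw [← finrank_L_K, Nat.card_eq_fintype_card]
    exact AlgEquiv.card_le
  · rw [← orderOf_galL h]
    exact orderOf_le_card

theorem isCyclic_galL : IsCyclic (K ≃ₐ[L] K) := by
  obtain ⟨τ, h⟩ := exists_galL_thetaK
  exact isCyclic_of_orderOf_eq_card τ ((orderOf_galL h).trans card_galL.symm)

instance isGalois_L : IsGalois L K :=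
  IsGalois.of_card_aut_eq_finrank L K (by rw [card_galL, finrank_L_K])

instance isGalois_F : IsGalois F K := by
  have := Algebra.IsQuadraticExtension.mk (R := F) (S := K) finrank_F_K
  exact { __ := this }

theorem card_galF : Nat.card (K ≃ₐ[F] K) = 2 := by
  rw [IsGalois.card_aut_eq_finrank, finrank_F_K]

theorem isCyclic_galF : IsCyclic (K ≃ₐ[F] K) :=
  have : Fact (Nat.Prime 2) := ⟨Nat.prime_two⟩
  isCyclic_of_prime_card card_galF

end MIDO

namespace MIDO

open Polynomial IntermediateField NumberField

/-! ### The unit `i` is not a norm from `K` to `L` -/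

/-- `i` as an algebraic integer of `K`. -/
noncomputable def iO : 𝓞 K := ⟨iK, isIntegral_iK⟩

/-- `θ` as an algebraic integer of `K`. -/
noncomputable def thetaO : 𝓞 K := ⟨thetaK, isIntegral_thetaK⟩

/-- The order `ℤ[i, θ]` of `K`. -/
noncomputable def order : Subalgebra ℤ (𝓞 K) := Algebra.adjoin ℤ {iO, thetaO}

/-- The action of an element of `Gal(K/L)` on the ring of integers of `K`. -/
noncomputable def galO (τ : K ≃ₐ[L] K) : 𝓞 K →+* 𝓞 K := RingOfIntegers.mapRingHom τ

theorem coe_iO : algebraMap (𝓞 K) K iO = iK := rfl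
theorem coe_thetaO : algebraMap (𝓞 K) K thetaO = thetaK := rfl

theorem coe_galO (τ : K ≃ₐ[L] K) (x : 𝓞 K) :
    algebraMap (𝓞 K) K (galO τ x) = τ (algebraMap (𝓞 K) K x) := rfl

theorem iO_sq : iO ^ 2 = -1 := by
  apply RingOfIntegers.coe_injective
  rw [map_pow, map_neg, map_one, coe_iO, iK_sq]

theorem thetaO_eq : thetaO ^ 4 - thetaO ^ 3 - 4 * thetaO ^ 2 + 4 * thetaO + 1 = 0 := by
  apply RingOfIntegers.coe_injective
  simpa only [coe_thetaO, map_sub, map_add, map_mul, map_pow, map_ofNat, map_one, map_zero]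
    using thetaK_eq

theorem iO_mem : iO ∈ order := Algebra.subset_adjoin (by simp)
theorem thetaO_mem : thetaO ∈ order := Algebra.subset_adjoin (by simp)

/-- `K` is the field of fractions of `ℤ[i, θ]`. -/
theorem exists_order_fraction (x : K) : ∃ a ∈ order, ∃ c ∈ order, c ≠ 0 ∧
    x * algebraMap (𝓞 K) K c = algebraMap (𝓞 K) K a := by
  induction x using K_induction with
  | hi => exact ⟨iO, iO_mem, 1, one_mem _, one_ne_zero, by simp [coe_iO]⟩
  | ht => exact ⟨thetaO, thetaO_mem, 1, one_mem _, one_ne_zero, by simp [coe_thetaO]⟩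
  | hq q =>
    refine ⟨q.num, intCast_mem _ _, q.den, natCast_mem _ _, by simp, ?_⟩
    have h2 := congrArg (algebraMap ℚ K) (Rat.mul_den_eq_num q)
    rw [map_mul, map_natCast, map_intCast] at h2
    rwa [map_natCast, map_intCast]
  | hadd x y hx hy =>
    obtain ⟨a, ha, c, hc, hc0, h1⟩ := hx
    obtain ⟨b, hb, d, hd, hd0, h2⟩ := hy
    refine ⟨a * d + b * c, add_mem (mul_mem ha hd) (mul_mem hb hc), c * d, mul_mem hc hd,
      mul_ne_zero hc0 hd0, ?_⟩
    simp only [map_add, map_mul]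
    rw [← h1, ← h2]
    ring
  | hinv x hx =>
    obtain ⟨a, ha, c, hc, hc0, h1⟩ := hx
    by_cases hx0 : x = 0
    · exact ⟨0, zero_mem _, 1, one_mem _, one_ne_zero, by simp [hx0]⟩
    refine ⟨c, hc, a, ha, ?_, ?_⟩
    · rintro rfl
      simp [hx0, hc0] at h1
    · rw [← h1, inv_mul_cancel_left₀ hx0]
  | hmul x y hx hy =>
    obtain ⟨a, ha, c, hc, hc0, h1⟩ := hx
    obtain ⟨b, hb, d, hd, hd0, h2⟩ := hy
    refine ⟨a * b, mul_mem ha hb, c * d, mul_mem hc hd, mul_ne_zero hc0 hd0, ?_⟩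
    simp only [map_mul]
    rw [← h1, ← h2]
    ring

/-- Modulo `θ + 1` every element of `ℤ[i, θ]` is a Gaussian integer. -/
theorem exists_eq_add_mul {x : 𝓞 K} (hx : x ∈ order) :
    ∃ m n : ℤ, ∃ y ∈ order, x = m + n * iO + (thetaO + 1) * y := by
  induction hx using Algebra.adjoin_induction with
  | mem x hx =>
    rcases hx with rfl | rfl
    · exact ⟨0, 1, 0, zero_mem _, by simp⟩
    · exact ⟨-1, 0, 1, one_mem _, by simp⟩
  | algebraMap r => exact ⟨r, 0, 0, zero_mem _, by simp⟩
  | add x y _ _ hx hy =>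
    obtain ⟨m, n, z, hz, rfl⟩ := hx
    obtain ⟨m', n', z', hz', rfl⟩ := hy
    exact ⟨m + m', n + n', z + z', add_mem hz hz', by push_cast; ring⟩
  | mul x y _ hy' hx hy =>
    obtain ⟨m, n, z, hz, rfl⟩ := hx
    obtain ⟨m', n', z', hz', h⟩ := hy
    refine ⟨m * m' - n * n', m * n' + n * m', (m + n * iO) * z' + z * y,
      add_mem (mul_mem (add_mem (intCast_mem _ _) (mul_mem (intCast_mem _ _) iO_mem)) hz')
        (mul_mem hz hy'), ?_⟩
    push_cast
    linear_combination (m + n * iO) * h + (n : 𝓞 K) * n' * iO_sq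

/-- There is a prime of `K` above `5`, and `i` is congruent to `2` or `-2` modulo it. -/
theorem exists_prime_over_five :
    ∃ P : Ideal (𝓞 K), P.IsPrime ∧ (5 : 𝓞 K) ∈ P ∧ ∃ e : ℤ, e ^ 2 = 4 ∧ iO - e ∈ P := by
  have hmax : (Ideal.span {(5 : ℤ)}).IsMaximal :=
    PrincipalIdealRing.isMaximal_of_irreducible (by norm_num : Prime (5 : ℤ)).irreducible
  obtain ⟨P, hP, hover⟩ :=
    Ideal.exists_maximal_ideal_liesOver_of_isIntegral (S := 𝓞 K) (Ideal.span {(5 : ℤ)})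
  have h5P : (5 : 𝓞 K) ∈ P := by
    have : (5 : ℤ) ∈ P.under ℤ := hover.over ▸ Ideal.mem_span_singleton_self _
    simpa [Ideal.mem_comap] using this
  refine ⟨P, hP.isPrime, h5P, ?_⟩
  have h : (iO - (2 : ℤ)) * (iO - (-2 : ℤ)) ∈ P := by
    have : (iO - (2 : ℤ)) * (iO - (-2 : ℤ)) = -5 := by
      push_cast
      linear_combination iO_sq
    rw [this]
    exact neg_mem h5P
  rcases hP.isPrime.mem_or_mem h with h | h
  · exact ⟨2, by norm_num, h⟩
  · exact ⟨-2, by norm_num, h⟩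

section Prime

variable {P : Ideal (𝓞 K)} [hP : P.IsPrime] (h5 : (5 : 𝓞 K) ∈ P) {e : ℤ} (he : e ^ 2 = 4)
  (hi : iO - e ∈ P)

include h5

theorem intCast_mem_iff (m : ℤ) : (m : 𝓞 K) ∈ P ↔ 5 ∣ m := by
  refine ⟨fun h => ?_, ?_⟩
  · by_contra h2
    have hc : IsCoprime (5 : ℤ) m :=
      (Prime.coprime_iff_not_dvd (by norm_num : Prime (5 : ℤ))).2 h2
    obtain ⟨a, b, hab⟩ := hc
    apply hP.ne_top
    rw [Ideal.eq_top_iff_one]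
    have : (1 : 𝓞 K) = a * 5 + b * m := by exact_mod_cast hab.symm
    rw [this]
    exact add_mem (P.mul_mem_left _ h5) (P.mul_mem_left _ h)
  · rintro ⟨k, rfl⟩
    push_cast
    exact P.mul_mem_right _ h5

/-- The minimal polynomial of `θ + 1` is `X⁴` modulo `5`. -/
theorem add_one_mem_of_eq {x : 𝓞 K} (hx : x ^ 4 - x ^ 3 - 4 * x ^ 2 + 4 * x + 1 = 0) :
    x + 1 ∈ P := by
  apply hP.mem_of_pow_mem 4
  have : (x + 1) ^ 4 = 5 * (x ^ 3 + 2 * x ^ 2) := by linear_combination hx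
  rw [this]
  exact P.mul_mem_right _ h5

theorem thetaO_add_one_mem : thetaO + 1 ∈ P := add_one_mem_of_eq h5 thetaO_eq

/-- The prime above `5` is totally ramified over `L`, so that `Gal(K/L)` acts trivially on
residues. -/
theorem galO_sub_mem (τ : K ≃ₐ[L] K) {x : 𝓞 K} (hx : x ∈ order) : galO τ x - x ∈ P := by
  induction hx using Algebra.adjoin_induction with
  | mem x hx =>
    rcases hx with rfl | rfl
    · have : galO τ iO = iO := RingOfIntegers.ext (galL_iK τ)
      simp [this]
    · have h := congrArg (galO τ) thetaO_eq
      simp only [map_sub, map_add, map_mul, map_pow, map_ofNat, map_one, map_zero] at h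
      have := sub_mem (add_one_mem_of_eq h5 h) (thetaO_add_one_mem h5)
      simpa using this
  | algebraMap r => simp
  | add x y _ _ hx hy =>
    have : galO τ (x + y) - (x + y) = (galO τ x - x) + (galO τ y - y) := by rw [map_add]; ring
    rw [this]
    exact add_mem hx hy
  | mul x y _ _ hx hy =>
    have : galO τ (x * y) - x * y = (galO τ x - x) * galO τ y + x * (galO τ y - y) := by
      rw [map_mul]; ring
    rw [this]
    exact add_mem (P.mul_mem_right _ hx) (P.mul_mem_left _ hy)

include hi

theorem exists_intCast_sub_mem {x : 𝓞 K} (hx : x ∈ order) : ∃ z : ℤ, x - z ∈ P := by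
  obtain ⟨m, n, y, hy, rfl⟩ := exists_eq_add_mul hx
  refine ⟨m + n * e, ?_⟩
  have : (m + n * iO + (thetaO + 1) * y) - ((m + n * e : ℤ) : 𝓞 K) =
      n * (iO - e) + (thetaO + 1) * y := by push_cast; ring
  rw [this]
  exact add_mem (P.mul_mem_left _ hi) (P.mul_mem_right _ (thetaO_add_one_mem h5))

/-- The residue field is `𝔽₅`, where nonzero elements have fourth power one. -/
theorem pow_four_sub_one_mem {x : 𝓞 K} (hx : x ∈ order) (hxP : x ∉ P) : x ^ 4 - 1 ∈ P := by
  obtain ⟨z, hz⟩ := exists_intCast_sub_mem h5 hi hx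
  have h1 : ¬ (5 : ℤ) ∣ z := by
    rw [← intCast_mem_iff h5]
    intro h
    apply hxP
    simpa using add_mem hz h
  have h2 : (5 : ℤ) ∣ z ^ 4 - 1 := by
    have : z % 5 = 1 ∨ z % 5 = 2 ∨ z % 5 = 3 ∨ z % 5 = 4 := by omega
    apply Int.dvd_of_emod_eq_zero
    rcases this with h | h | h | h <;> simp [Int.sub_emod, pow_succ, Int.mul_emod, h]
  have h3 : x ^ 4 - 1 = (x - z) * (x ^ 3 + x ^ 2 * z + x * z ^ 2 + z ^ 3) +
      ((z ^ 4 - 1 : ℤ) : 𝓞 K) := by push_cast; ring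
  rw [h3]
  exact add_mem (P.mul_mem_right _ hz) ((intCast_mem_iff h5 _).2 h2)

theorem norm_sub_pow_mem (τ : K ≃ₐ[L] K) {x : 𝓞 K} (hx : x ∈ order) (hxP : x ∉ P) :
    x * galO τ x * galO (τ ^ 2) x * galO (τ ^ 3) x - 1 ∈ P := by
  have h := fun k : ℕ => galO_sub_mem h5 (τ ^ k) hx
  have h1 := h 1
  rw [pow_one] at h1
  have : x * galO τ x * galO (τ ^ 2) x * galO (τ ^ 3) x - 1 =
      (galO τ x - x) * (x * galO (τ ^ 2) x * galO (τ ^ 3) x) +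
      (galO (τ ^ 2) x - x) * (x ^ 2 * galO (τ ^ 3) x) + (galO (τ ^ 3) x - x) * x ^ 3 +
      (x ^ 4 - 1) := by ring
  rw [this]
  exact add_mem (add_mem (add_mem (P.mul_mem_right _ h1) (P.mul_mem_right _ (h 2)))
    (P.mul_mem_right _ (h 3))) (pow_four_sub_one_mem h5 hi hx hxP)

include he

/-- Up to units at `P`, the element `θ + 1` divides every element of `P ∩ ℤ[i, θ]`: the
complementary factor `i + e` of `5` is such a unit. -/
theorem exists_mul_eq_mul {x : 𝓞 K} (hx : x ∈ order) (hxP : x ∈ P) :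
    ∃ y ∈ order, (iO + e) * x = (thetaO + 1) * y := by
  obtain ⟨m, n, y, hy, rfl⟩ := exists_eq_add_mul hx
  have h1 : (5 : ℤ) ∣ m + n * e := by
    rw [← intCast_mem_iff h5]
    have : ((m + n * e : ℤ) : 𝓞 K) =
        (m + n * iO + (thetaO + 1) * y) - (n * (iO - e) + (thetaO + 1) * y) := by
      push_cast; ring
    rw [this]
    exact sub_mem hxP (add_mem (P.mul_mem_left _ hi)
      (P.mul_mem_right _ (thetaO_add_one_mem h5)))
  obtain ⟨k, hk⟩ := h1
  have hk' : (m : 𝓞 K) + n * e = 5 * k := by exact_mod_cast hk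
  have he' : (e : 𝓞 K) ^ 2 = 4 := by exact_mod_cast he
  have hie : iO + e ∈ order := add_mem iO_mem (intCast_mem _ _)
  -- the constant term of the minimal polynomial of `θ + 1` is `-5`
  refine ⟨((thetaO + 1) ^ 3 - 5 * (thetaO + 1) ^ 2 + 5 * (thetaO + 1) + 5) *
    (k * (iO + e) - n) + (iO + e) * y, ?_, ?_⟩
  · have ht : thetaO + 1 ∈ order := add_mem thetaO_mem (one_mem _)
    have h5' : (5 : 𝓞 K) ∈ order := ofNat_mem _ 5
    exact add_mem (mul_mem (add_mem (add_mem (sub_mem (pow_mem ht 3)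
      (mul_mem h5' (pow_mem ht 2))) (mul_mem h5' ht)) h5')
      (sub_mem (mul_mem (intCast_mem _ _) hie) (intCast_mem _ _))) (mul_mem hie hy)
  · linear_combination (iO + e) * hk' + (n : 𝓞 K) * iO_sq - (n : 𝓞 K) * he' -
      (k * (iO + e) - n) * thetaO_eq

theorem iO_add_notMem : iO + e ∉ P := by
  intro h
  have h2 : ((2 * e : ℤ) : 𝓞 K) ∈ P := by
    have : ((2 * e : ℤ) : 𝓞 K) = (iO + e) - (iO - e) := by push_cast; ring
    rw [this]
    exact sub_mem h hi
  rw [intCast_mem_iff h5] at h2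
  obtain ⟨k, hk⟩ := h2
  have : (25 : ℤ) * k ^ 2 = 16 := by linear_combination 4 * he - (2 * e + 5 * k) * hk
  omega

theorem exists_eq_pow_mul_of_notMem (n : ℕ) {x : 𝓞 K} (hx : x ∈ order) (hxP : x ∉ P ^ n) :
    ∃ m : ℕ, ∃ d ∈ order, ∃ u ∈ order, d ∉ P ∧ u ∉ P ∧ d * x = (thetaO + 1) ^ m * u := by
  induction n generalizing x with
  | zero => simp at hxP
  | succ n ih =>
    by_cases hx1 : x ∈ P
    · obtain ⟨y, hy, h⟩ := exists_mul_eq_mul h5 he hi hx hx1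
      have hyP : y ∉ P ^ n := by
        intro hyn
        have hP0 : P ≠ ⊥ := by
          rintro rfl
          norm_num at h5
        have h2 : x * (iO + e) ∈ P ^ (n + 1) := by
          rw [mul_comm, h, pow_succ']
          exact Ideal.mul_mem_mul (thetaO_add_one_mem h5) hyn
        exact iO_add_notMem h5 he hi (Ideal.mem_prime_of_mul_mem_pow hP0 hxP h2)
      obtain ⟨m, d, hd, u, hu, hdP, huP, h3⟩ := ih hy hyP
      refine ⟨m + 1, d * (iO + e), mul_mem hd (add_mem iO_mem (intCast_mem _ _)), u, hu,
        hP.mul_notMem hdP (iO_add_notMem h5 he hi), huP, ?_⟩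
      rw [mul_assoc, h, pow_succ]
      linear_combination (thetaO + 1) * h3
    · exact ⟨0, 1, one_mem _, x, hx, hP.one_notMem, hx1, by simp⟩

/-- The element `θ + 1` is a uniformizer at `P`. -/
theorem exists_eq_pow_mul {x : 𝓞 K} (hx : x ∈ order) (hx0 : x ≠ 0) :
    ∃ m : ℕ, ∃ d ∈ order, ∃ u ∈ order, d ∉ P ∧ u ∉ P ∧ d * x = (thetaO + 1) ^ m * u := by
  obtain ⟨n, hn⟩ : ∃ n, x ∉ P ^ n := by
    by_contra! h
    apply hx0
    have := Ideal.iInf_pow_eq_bot_of_isDomain P hP.ne_top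
    rw [← Ideal.mem_bot, ← this, Ideal.mem_iInf]
    exact h
  exact exists_eq_pow_mul_of_notMem h5 he hi n hx hn

end Prime

/-- The unit `i` of `L` is not a norm from `K`: the prime `P` above `5` is totally and tamely
ramified in `K/L`, so the norm of a unit at `P` is a fourth power, that is `1`, in the residue
field `𝔽₅`, while `i` reduces to `2` or `-2`. -/
theorem norm_ne_iK (τ : K ≃ₐ[L] K) (a : K) : a * τ a * (τ ^ 2) a * (τ ^ 3) a ≠ iK := by
  intro hN
  obtain ⟨P, hP, h5, e, he, hi⟩ := exists_prime_over_five
  have ha0 : a ≠ 0 := by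
    rintro rfl
    have := iK_sq
    simp [← hN] at this
  obtain ⟨x, hx, c, hc, hc0, hac⟩ := exists_order_fraction a
  have hx0 : x ≠ 0 := by
    rintro rfl
    simp [ha0, hc0] at hac
  obtain ⟨m, d, hd, u, hu, hdP, huP, h1⟩ := exists_eq_pow_mul h5 he hi hx hx0
  obtain ⟨m', d', hd', u', hu', hdP', huP', h2⟩ := exists_eq_pow_mul h5 he hi hc hc0
  let N : 𝓞 K →* 𝓞 K :=
    { toFun := fun x => x * galO τ x * galO (τ ^ 2) x * galO (τ ^ 3) x
      map_one' := by simp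
      map_mul' := fun x y => by simp only [map_mul]; ring }
  have hNdef : ∀ x, N x = x * galO τ x * galO (τ ^ 2) x * galO (τ ^ 3) x := fun x => rfl
  have hNc : iO * N c = N x := by
    apply RingOfIntegers.coe_injective
    rw [hNdef, hNdef]
    simp only [map_mul, coe_galO, ← hac]
    rw [coe_iO, ← hN]
    ring
  have hNt : N (thetaO + 1) ∈ P :=
    P.mul_mem_right _ (P.mul_mem_right _ (P.mul_mem_right _ (thetaO_add_one_mem h5)))
  have hNt0 : N (thetaO + 1) ≠ 0 := by
    have h0 : thetaO + 1 ≠ 0 := by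
      intro h
      have h3 := thetaO_eq
      rw [eq_neg_of_add_eq_zero_left h] at h3
      norm_num at h3
    have hinj : ∀ k : ℕ, galO (τ ^ k) (thetaO + 1) ≠ 0 := fun k h => h0 <| by
      have h3 := congrArg (algebraMap (𝓞 K) K) h
      rw [coe_galO, map_zero, map_eq_zero_iff _ (AlgEquiv.injective _)] at h3
      exact RingOfIntegers.coe_injective (by rw [h3, map_zero])
    rw [hNdef]
    refine mul_ne_zero (mul_ne_zero (mul_ne_zero h0 ?_) (hinj 2)) (hinj 3)
    simpa using hinj 1
  have hw : N (d * u') - 1 ∈ P :=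
    norm_sub_pow_mem h5 hi τ (mul_mem hd hu') (hP.mul_notMem hdP huP')
  have hw' : N (d' * u) - 1 ∈ P :=
    norm_sub_pow_mem h5 hi τ (mul_mem hd' hu) (hP.mul_notMem hdP' huP)
  have key : iO * N (d * u') * N (thetaO + 1) ^ m' = N (d' * u) * N (thetaO + 1) ^ m := by
    have e1 := congrArg N h1
    have e2 := congrArg N h2
    simp only [map_mul, map_pow] at e1 e2 ⊢
    linear_combination N d' * e1 - iO * N d * e2 + N d * N d' * hNc
  have hone : (1 : 𝓞 K) ∉ P := hP.one_notMem
  have hbad : iO - 1 ∉ P := by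
    intro h
    have h3 : ((e - 1 : ℤ) : 𝓞 K) ∈ P := by
      have : ((e - 1 : ℤ) : 𝓞 K) = (iO - 1) - (iO - e) := by push_cast; ring
      rw [this]
      exact sub_mem h hi
    rw [intCast_mem_iff h5] at h3
    have : e = 2 ∨ e = -2 := sq_eq_sq_iff_eq_or_eq_neg.1 (by rw [he]; norm_num)
    omega
  have hiO : iO ∉ P := fun h => hone <| by
    have : (1 : 𝓞 K) = -(iO * iO) := by linear_combination iO_sq
    rw [this]
    exact neg_mem (P.mul_mem_right _ h)
  rcases lt_trichotomy m m' with h | rfl | h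
  · obtain ⟨k, rfl⟩ := Nat.exists_eq_add_of_lt h
    have h3 : iO * N (d * u') * N (thetaO + 1) ^ (k + 1) = N (d' * u) := by
      apply mul_right_cancel₀ (pow_ne_zero m hNt0)
      rw [← key]
      ring
    apply hone
    have : (1 : 𝓞 K) = iO * N (d * u') * N (thetaO + 1) ^ (k + 1) - (N (d' * u) - 1) := by
      rw [h3]; ring
    rw [this]
    exact sub_mem (P.mul_mem_left _ (Ideal.pow_mem_of_mem _ hNt _ (by omega))) hw'
  · have h3 : iO * N (d * u') = N (d' * u) := mul_right_cancel₀ (pow_ne_zero m hNt0) key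
    apply hbad
    have : iO - 1 = (N (d' * u) - 1) - iO * (N (d * u') - 1) := by rw [← h3]; ring
    rw [this]
    exact sub_mem hw' (P.mul_mem_left _ hw)
  · obtain ⟨k, rfl⟩ := Nat.exists_eq_add_of_lt h
    have h3 : iO * N (d * u') = N (d' * u) * N (thetaO + 1) ^ (k + 1) := by
      apply mul_right_cancel₀ (pow_ne_zero m' hNt0)
      rw [key]
      ring
    apply hiO
    have : iO = N (d' * u) * N (thetaO + 1) ^ (k + 1) - iO * (N (d * u') - 1) := by
      rw [← h3]; ring
    rw [this]
    exact sub_mem (P.mul_mem_left _ (Ideal.pow_mem_of_mem _ hNt _ (by omega)))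
      (P.mul_mem_left _ hw)

end MIDO

namespace MIDO

open IntermediateField

/-! ### The quaternion algebra over `F` -/

theorem galF_thetaK (σ : K ≃ₐ[F] K) : σ thetaK = thetaK :=
  σ.commutes ⟨thetaK, mem_adjoin_simple_self ℚ thetaK⟩

theorem galF_iK {σ : K ≃ₐ[F] K} (hσ : Subgroup.zpowers σ = ⊤) : σ iK = -iK := by
  have h : (σ iK - iK) * (σ iK + iK) = 0 := by
    have := congrArg σ iK_sq
    simp only [map_pow, map_neg, map_one] at this
    linear_combination this - iK_sq
  rcases mul_eq_zero.1 h with h | h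
  · exfalso
    have h1 : σ = 1 := by
      ext1 x
      exact ringHom_ext (f := (σ : K →+* K)) (g := RingHom.id K) (sub_eq_zero.1 h)
        (galF_thetaK σ) x
    have h2 := card_galF
    rw [← Subgroup.card_top, ← hσ, h1, Nat.card_zpowers, orderOf_one] at h2
    omega
  · exact eq_neg_of_add_eq_zero_left h

section Quaternion

variable {σ : K ≃ₐ[F] K} (hi : σ iK = -iK)

include hi

/-- The generator of `Gal(K/F)` is complex conjugation. -/
theorem coe_galF (x : K) : ((σ x : K) : ℂ) = starRingEnd ℂ x := by
  refine ringHom_ext (f := (algebraMap K ℂ).comp (σ : K →+* K))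
    (g := (starRingEnd ℂ).comp (algebraMap K ℂ)) ?_ ?_ x
  · change ((σ iK : K) : ℂ) = starRingEnd ℂ iK
    rw [hi, coe_iK, Complex.conj_I]
    rfl
  · change ((σ thetaK : K) : ℂ) = starRingEnd ℂ thetaK
    rw [galF_thetaK, star_thetaK]

theorem galF_galF (x : K) : σ (σ x) = x := by
  apply Subtype.ext
  rw [coe_galF hi, coe_galF hi, Complex.conj_conj]

omit hi in
/-- `Gal(K/L)` maps `θ` into `F`, as it permutes the roots of the minimal polynomial of `θ`. -/
theorem galF_galL_thetaK (σ : K ≃ₐ[F] K) (τ : K ≃ₐ[L] K) : σ (τ thetaK) = τ thetaK := by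
  have h := congrArg τ thetaK_eq
  simp only [map_sub, map_add, map_mul, map_pow, map_ofNat, map_one, map_zero] at h
  rcases eq_root_of_eq_zero h with h | h | h | h <;> rw [h] <;>
    simp only [map_add, map_sub, map_mul, map_neg, map_pow, map_ofNat, map_one, galF_thetaK]

theorem galL_galF_comm (τ : K ≃ₐ[L] K) (x : K) : τ (σ x) = σ (τ x) := by
  refine ringHom_ext (f := (τ : K →+* K).comp (σ : K →+* K))
    (g := (σ : K →+* K).comp (τ : K →+* K)) ?_ ?_ x
  · change τ (σ iK) = σ (τ iK)
    rw [hi, galL_iK, map_neg, galL_iK, hi]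
  · change τ (σ thetaK) = σ (τ thetaK)
    rw [galF_thetaK, galF_galL_thetaK]

/-- The reduced norm `a σ(a) + b σ(b)` is the sum of squares `|a|² + |b|²`. -/
theorem add_mul_galF_ne_zero {a b : K} (h : a ≠ 0 ∨ b ≠ 0) : a * σ a + b * σ b ≠ 0 := by
  intro h0
  have h1 := congrArg (algebraMap K ℂ) h0
  simp only [map_add, map_mul, map_zero] at h1
  have hc : ∀ x : K, algebraMap K ℂ x * algebraMap K ℂ (σ x) = (Complex.normSq x : ℂ) := by
    intro x
    rw [show algebraMap K ℂ (σ x) = starRingEnd ℂ (x : ℂ) from coe_galF hi x]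
    exact Complex.mul_conj _
  rw [hc, hc] at h1
  norm_cast at h1
  have ha := Complex.normSq_nonneg (a : ℂ)
  have hb := Complex.normSq_nonneg (b : ℂ)
  have ha0 : Complex.normSq (a : ℂ) = 0 := by linarith
  have hb0 : Complex.normSq (b : ℂ) = 0 := by linarith
  rw [Complex.normSq_eq_zero, ZeroMemClass.coe_eq_zero] at ha0 hb0
  tauto

end Quaternion

section Algebra

variable {σ : K ≃ₐ[F] K} [hσ : Fact (∀ x, σ (σ x) = x)] (hi : σ iK = -iK)

/-- Left multiplication by elements of `K ⊕ jK` as a ring homomorphism to matrices. -/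
noncomputable def toMatrixHom : CyclicAlgebra σ (-1 : F) →+* Matrix (Fin 2) (Fin 2) K where
  toFun := CyclicAlgebra.toMatrix
  map_one' := by ext i j; fin_cases i <;> fin_cases j <;> simp [CyclicAlgebra.toMatrix]
  map_zero' := by ext i j; fin_cases i <;> fin_cases j <;> simp [CyclicAlgebra.toMatrix]
  map_add' A B := by
    ext i j
    fin_cases i <;> fin_cases j <;> simp [CyclicAlgebra.toMatrix, add_comm]
  map_mul' A B := by
    ext i j
    fin_cases i <;> fin_cases j <;>
      simp [CyclicAlgebra.toMatrix, Matrix.mul_apply, hσ.out] <;> ring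

theorem toMatrixHom_apply (A : CyclicAlgebra σ (-1 : F)) : toMatrixHom A = A.toMatrix := rfl

include hi

/-- The quaternion algebra `(-1, -1)` over the real field `F` is a division algebra. -/
theorem isUnit_of_ne_zero {A : CyclicAlgebra σ (-1 : F)} (hA : A ≠ 0) : IsUnit A := by
  have hn : A.fst * σ A.fst + A.snd * σ A.snd ≠ 0 := by
    apply add_mul_galF_ne_zero hi
    by_contra! h
    exact hA (CyclicAlgebra.ext h.1 h.2)
  set n := A.fst * σ A.fst + A.snd * σ A.snd with hndef
  have hσn : σ n = n := by
    rw [hndef]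
    simp only [map_add, map_mul, hσ.out]
    ring
  have hnn : n * n⁻¹ = 1 := mul_inv_cancel₀ hn
  let B : CyclicAlgebra σ (-1 : F) := ⟨σ A.fst * n⁻¹, -A.snd * n⁻¹⟩
  refine ⟨⟨A, B, ?_, ?_⟩, rfl⟩
  · refine CyclicAlgebra.ext ?_ ?_
    · simp only [CyclicAlgebra.mul_fst, CyclicAlgebra.one_fst, B, map_neg, map_one]
      linear_combination hnn - n⁻¹ * hndef
    · simp only [CyclicAlgebra.mul_snd, CyclicAlgebra.one_snd, B]
      ring
  · refine CyclicAlgebra.ext ?_ ?_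
    · simp only [CyclicAlgebra.mul_fst, CyclicAlgebra.one_fst, B, map_neg, map_one, map_mul,
        map_inv₀, hσn]
      linear_combination hnn - n⁻¹ * hndef
    · simp only [CyclicAlgebra.mul_snd, CyclicAlgebra.one_snd, B, map_mul, map_inv₀, hσn, hσ.out]
      ring

/-- The map `Υ` as a ring endomorphism. -/
noncomputable def upsilonHom (τ : K ≃ₐ[L] K) :
    CyclicAlgebra σ (-1 : F) →+* CyclicAlgebra σ (-1 : F) where
  toFun := CyclicAlgebra.upsilon τ
  map_one' := by ext <;> simp [CyclicAlgebra.upsilon]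
  map_zero' := by ext <;> simp [CyclicAlgebra.upsilon]
  map_add' A B := by ext <;> simp [CyclicAlgebra.upsilon]
  map_mul' A B := by ext <;> simp [CyclicAlgebra.upsilon, galL_galF_comm hi]

theorem upsilonHom_apply (τ : K ≃ₐ[L] K) (A : CyclicAlgebra σ (-1 : F)) :
    upsilonHom hi τ A = A.upsilon τ := rfl

omit hi in
theorem galL_pow_four (τ : K ≃ₐ[L] K) : τ ^ 4 = 1 := by
  rw [← card_galL]
  exact pow_card_eq_one'

theorem upsilonHom_four (τ : K ≃ₐ[L] K) (A : CyclicAlgebra σ (-1 : F)) :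
    upsilonHom hi τ (upsilonHom hi τ (upsilonHom hi τ (upsilonHom hi τ A))) = A := by
  have h : ∀ x, τ (τ (τ (τ x))) = x := fun x => DFunLike.congr_fun (galL_pow_four τ) x
  exact CyclicAlgebra.ext (h _) (h _)

/-- If `A Υ(A) Υ²(A) Υ³(A) = i`, applying `Υ` shows that `A` commutes with `i`, so that `A` lies
in `K` and has norm `i`. -/
theorem mul_upsilonHom_ne_iK (τ : K ≃ₐ[L] K) (A : CyclicAlgebra σ (-1 : F)) :
    A * upsilonHom hi τ A * upsilonHom hi τ (upsilonHom hi τ A) *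
      upsilonHom hi τ (upsilonHom hi τ (upsilonHom hi τ A)) ≠ CyclicAlgebra.ofField iK := by
  intro h
  have h1 := congrArg (upsilonHom hi τ) h
  simp only [map_mul, upsilonHom_four] at h1
  have h2 : upsilonHom hi τ (CyclicAlgebra.ofField iK) = CyclicAlgebra.ofField iK :=
    CyclicAlgebra.ext (galL_iK τ) (map_zero τ)
  rw [h2] at h1
  have hcomm : A * CyclicAlgebra.ofField iK = CyclicAlgebra.ofField iK * A := by
    nth_rewrite 1 [← h1]
    rw [← h]
    simp only [mul_assoc]
  have hb := congrArg CyclicAlgebra.snd hcomm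
  simp only [CyclicAlgebra.mul_snd, CyclicAlgebra.ofField, mul_zero, zero_add, zero_mul, add_zero,
    hi] at hb
  have hi0 : iK ≠ 0 := fun h => by simpa [h] using iK_sq
  have hb0 : A.snd = 0 := by
    have : 2 * iK * A.snd = 0 := by linear_combination hb
    simpa [hi0] using this
  have ha := congrArg CyclicAlgebra.fst h
  simp only [CyclicAlgebra.mul_fst, CyclicAlgebra.mul_snd, upsilonHom_apply,
    CyclicAlgebra.upsilon, hb0, map_zero, mul_zero, zero_mul, add_zero,
    CyclicAlgebra.ofField] at ha
  exact norm_ne_iK τ A.fst ha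

/-- The same for every square root of `-1`, since these are the conjugates of `i`. -/
theorem mul_upsilonHom_sq_ne_neg_one (τ : K ≃ₐ[L] K) (A : CyclicAlgebra σ (-1 : F)) :
    (A * upsilonHom hi τ A * upsilonHom hi τ (upsilonHom hi τ A) *
      upsilonHom hi τ (upsilonHom hi τ (upsilonHom hi τ A))) ^ 2 ≠ -1 := by
  intro h
  set B := A * upsilonHom hi τ A * upsilonHom hi τ (upsilonHom hi τ A) *
      upsilonHom hi τ (upsilonHom hi τ (upsilonHom hi τ A)) with hB
  obtain ⟨q, hq0, hq⟩ : ∃ q : CyclicAlgebra σ (-1 : F), q ≠ 0 ∧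
      B * q = q * CyclicAlgebra.ofField iK := by
    have hii : (CyclicAlgebra.ofField iK : CyclicAlgebra σ (-1 : F)) *
        CyclicAlgebra.ofField iK = -1 := by
      have := iK_sq
      refine CyclicAlgebra.ext ?_ ?_ <;> simp [CyclicAlgebra.ofField, this, ← pow_two iK]
    by_cases hBi : B + CyclicAlgebra.ofField iK = 0
    · refine ⟨⟨0, 1⟩, fun h => by simpa using congrArg CyclicAlgebra.snd h, ?_⟩
      rw [eq_neg_of_add_eq_zero_left hBi]
      ext <;> simp [CyclicAlgebra.ofField, hi]
    · refine ⟨_, hBi, ?_⟩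
      rw [mul_add, add_mul, hii, ← pow_two, h, add_comm]
  obtain ⟨u, rfl⟩ := isUnit_of_ne_zero hi hq0
  have hu : ∀ k : CyclicAlgebra σ (-1 : F) →+* CyclicAlgebra σ (-1 : F),
      k u * k (↑u⁻¹ : CyclicAlgebra σ (-1 : F)) = 1 := fun k => by
    rw [← map_mul, Units.mul_inv, map_one]
  apply mul_upsilonHom_ne_iK hi τ ((↑u⁻¹ : CyclicAlgebra σ (-1 : F)) * A * upsilonHom hi τ u)
  have hu1 := hu (upsilonHom hi τ)
  have hu2 := hu ((upsilonHom hi τ).comp (upsilonHom hi τ))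
  have hu3 := hu ((upsilonHom hi τ).comp ((upsilonHom hi τ).comp (upsilonHom hi τ)))
  simp only [RingHom.comp_apply] at hu2 hu3
  calc _ = (↑u⁻¹ : CyclicAlgebra σ (-1 : F)) * A *
        (upsilonHom hi τ u * upsilonHom hi τ (↑u⁻¹ : CyclicAlgebra σ (-1 : F))) *
        upsilonHom hi τ A * (upsilonHom hi τ (upsilonHom hi τ u) *
          upsilonHom hi τ (upsilonHom hi τ (↑u⁻¹ : CyclicAlgebra σ (-1 : F)))) *
        upsilonHom hi τ (upsilonHom hi τ A) *
        (upsilonHom hi τ (upsilonHom hi τ (upsilonHom hi τ u)) *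
          upsilonHom hi τ (upsilonHom hi τ (upsilonHom hi τ
            (↑u⁻¹ : CyclicAlgebra σ (-1 : F))))) *
        upsilonHom hi τ (upsilonHom hi τ (upsilonHom hi τ A)) *
        upsilonHom hi τ (upsilonHom hi τ (upsilonHom hi τ (upsilonHom hi τ u))) := by
        simp only [map_mul, mul_assoc]
    _ = (↑u⁻¹ : CyclicAlgebra σ (-1 : F)) * (B * u) := by
        rw [hu1, hu2, hu3, upsilonHom_four, hB]
        simp only [mul_one, mul_assoc]
    _ = CyclicAlgebra.ofField iK := by
        rw [hq, Units.inv_mul_cancel_left]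

end Algebra

end MIDO

namespace MIDO

open IntermediateField Matrix

/-! ### The determinant of a codeword -/

section Block

variable {σ : K ≃ₐ[F] K} [hσ : Fact (∀ x, σ (σ x) = x)] (hi : σ iK = -iK)

/-- The block matrix of a codeword with layers `A₀` and `A₁`. -/
noncomputable def blockMatrix (τ : K ≃ₐ[L] K) (A₀ A₁ : CyclicAlgebra σ (-1 : F)) :
    Matrix (Fin 4) (Fin 4) (Matrix (Fin 2) (Fin 2) K) :=
  !![toMatrixHom A₀, 0, 0,
      iK • toMatrixHom (upsilonHom hi τ (upsilonHom hi τ (upsilonHom hi τ A₁)));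
     toMatrixHom A₁, toMatrixHom (upsilonHom hi τ A₀), 0, 0;
     0, toMatrixHom (upsilonHom hi τ A₁), toMatrixHom (upsilonHom hi τ (upsilonHom hi τ A₀)), 0;
     0, 0, toMatrixHom (upsilonHom hi τ (upsilonHom hi τ A₁)),
      toMatrixHom (upsilonHom hi τ (upsilonHom hi τ (upsilonHom hi τ A₀)))]

theorem map_toMatrixHom (τ : K ≃ₐ[L] K) (A : CyclicAlgebra σ (-1 : F)) :
    (toMatrixHom A).map τ = toMatrixHom (upsilonHom hi τ A) := by
  ext i j
  fin_cases i <;> fin_cases j <;>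
    simp [toMatrixHom_apply, CyclicAlgebra.toMatrix, upsilonHom_apply, CyclicAlgebra.upsilon,
      galL_galF_comm hi]

theorem codewordK_eq (τ : K ≃ₐ[L] K) (s : Fin 2 × Fin 8 → GaussianInt) :
    codewordK σ τ s = comp _ _ _ _ _ (blockMatrix hi τ (layer σ s 0) (layer σ s 1)) := by
  have h1 : ∀ A : CyclicAlgebra σ (-1 : F), A.toMatrix.map (τ ^ 1 : K ≃ₐ[L] K) =
      toMatrixHom (upsilonHom hi τ A) := fun A => map_toMatrixHom hi (τ ^ 1) A
  have h2 : ∀ A : CyclicAlgebra σ (-1 : F), A.toMatrix.map (τ ^ 2 : K ≃ₐ[L] K) =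
      toMatrixHom (upsilonHom hi τ (upsilonHom hi τ A)) :=
    fun A => map_toMatrixHom hi (τ ^ 2) A
  have h3 : ∀ A : CyclicAlgebra σ (-1 : F), A.toMatrix.map (τ ^ 3 : K ≃ₐ[L] K) =
      toMatrixHom (upsilonHom hi τ (upsilonHom hi τ (upsilonHom hi τ A))) :=
    fun A => map_toMatrixHom hi (τ ^ 3) A
  simp only [codewordK, h1, h2, h3]
  rfl

omit hσ hi in
theorem comp_mulVec {m n R : Type*} [Fintype m] [Fintype n] [CommRing R]
    (X : Matrix m m (Matrix n n R)) (v : m × n → R) (i : m) (j : n) :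
    (comp _ _ _ _ _ X *ᵥ v) (i, j) = (∑ k, X i k *ᵥ fun l => v (k, l)) j := by
  simp [mulVec, dotProduct, Fintype.sum_prod_type, Finset.sum_apply]

/-- A matrix of a unit of the quaternion algebra has trivial kernel. -/
theorem toMatrixHom_mulVec_eq_zero {A : CyclicAlgebra σ (-1 : F)} (hA : IsUnit A)
    {v : Fin 2 → K} (h : toMatrixHom A *ᵥ v = 0) : v = 0 := by
  obtain ⟨u, rfl⟩ := hA
  have h1 := congrArg (toMatrixHom (↑u⁻¹ : CyclicAlgebra σ (-1 : F)) *ᵥ ·) h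
  simpa only [mulVec_mulVec, ← map_mul, Units.inv_mul, map_one, one_mulVec, mulVec_zero] using h1

include hi

/-- The characteristic polynomial of a quaternion has coefficients in the real field `F`, so that
it has the root `-i` only if it is `X² + 1`. -/
theorem sq_eq_neg_one_of_mulVec {B : CyclicAlgebra σ (-1 : F)} {w : Fin 2 → K} (hw : w ≠ 0)
    (h : toMatrixHom B *ᵥ w = -(iK • w)) : B ^ 2 = -1 := by
  have h1 : (toMatrixHom B + iK • (1 : Matrix (Fin 2) (Fin 2) K)) *ᵥ w = 0 := by
    rw [add_mulVec, smul_mulVec, one_mulVec, h, neg_add_cancel]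
  have h2 := exists_mulVec_eq_zero_iff.1 ⟨w, hw, h1⟩
  rw [det_fin_two] at h2
  simp only [toMatrixHom_apply, CyclicAlgebra.toMatrix, Matrix.add_apply, Matrix.smul_apply,
    Matrix.of_apply, Matrix.cons_val_zero, Matrix.cons_val_one, Matrix.cons_val',
    Matrix.cons_val_fin_one, Matrix.one_apply_eq, Matrix.one_apply_ne (by decide : (0 : Fin 2) ≠ 1),
    Matrix.one_apply_ne (by decide : (1 : Fin 2) ≠ 0), smul_eq_mul, map_neg, map_one, mul_one,
    mul_zero, add_zero] at h2
  have hsq := iK_sq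
  have h3 : B.fst * σ B.fst + B.snd * σ B.snd - 1 + iK * (B.fst + σ B.fst) = 0 := by
    linear_combination h2 - hsq
  have h4 := congrArg σ h3
  simp only [map_add, map_sub, map_mul, map_one, map_zero, hσ.out, hi] at h4
  have hi0 : iK ≠ 0 := fun h => by simp [h] at hsq
  have hN : B.fst * σ B.fst + B.snd * σ B.snd = 1 := by
    have : 2 * (B.fst * σ B.fst + B.snd * σ B.snd - 1) = 0 := by linear_combination h3 + h4
    simpa [sub_eq_zero] using this
  have hT : B.fst + σ B.fst = 0 := by
    have : 2 * iK * (B.fst + σ B.fst) = 0 := by linear_combination h3 - h4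
    simpa [hi0] using this
  rw [pow_two]
  refine CyclicAlgebra.ext ?_ ?_
  · simp only [CyclicAlgebra.mul_fst, CyclicAlgebra.neg_fst, CyclicAlgebra.one_fst, map_neg,
      map_one]
    linear_combination B.fst * hT - hN
  · simp only [CyclicAlgebra.mul_snd, CyclicAlgebra.neg_snd, CyclicAlgebra.one_snd, neg_zero]
    linear_combination B.snd * hT

/-- A kernel vector of the block matrix would, after elimination of its components, be an
eigenvector for `-i` of `Υ³(C) Υ²(C) Υ(C) C` with `C = A₁ A₀⁻¹`. -/
theorem det_blockMatrix_ne_zero (τ : K ≃ₐ[L] K) {A₀ A₁ : CyclicAlgebra σ (-1 : F)}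
    (hA : A₀ ≠ 0 ∨ A₁ ≠ 0) : (comp _ _ _ _ _ (blockMatrix hi τ A₀ A₁)).det ≠ 0 := by
  intro hdet
  obtain ⟨v, hv0, hv⟩ := exists_mulVec_eq_zero_iff.2 hdet
  let U := upsilonHom hi τ
  let w : Fin 4 → Fin 2 → K := fun k l => v (k, l)
  have hrow : ∀ k, ∑ l, blockMatrix hi τ A₀ A₁ k l *ᵥ w l = 0 := fun k => by
    ext j
    rw [← comp_mulVec, hv]
    rfl
  have hwne : ¬ (w 0 = 0 ∧ w 1 = 0 ∧ w 2 = 0 ∧ w 3 = 0) := by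
    rintro ⟨h0, h1, h2, h3⟩
    apply hv0
    funext ⟨k, j⟩
    fin_cases k
    exacts [congrFun h0 j, congrFun h1 j, congrFun h2 j, congrFun h3 j]
  have e0 := hrow 0
  have e1 := hrow 1
  have e2 := hrow 2
  have e3 := hrow 3
  rw [Fin.sum_univ_four] at e0 e1 e2 e3
  change toMatrixHom A₀ *ᵥ w 0 + 0 *ᵥ w 1 + 0 *ᵥ w 2 +
    (iK • toMatrixHom (U (U (U A₁)))) *ᵥ w 3 = 0 at e0
  change toMatrixHom A₁ *ᵥ w 0 + toMatrixHom (U A₀) *ᵥ w 1 + 0 *ᵥ w 2 + 0 *ᵥ w 3 = 0 at e1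
  change 0 *ᵥ w 0 + toMatrixHom (U A₁) *ᵥ w 1 + toMatrixHom (U (U A₀)) *ᵥ w 2 + 0 *ᵥ w 3 = 0 at e2
  change 0 *ᵥ w 0 + 0 *ᵥ w 1 + toMatrixHom (U (U A₁)) *ᵥ w 2 +
    toMatrixHom (U (U (U A₀))) *ᵥ w 3 = 0 at e3
  simp only [zero_mulVec, add_zero, zero_add, smul_mulVec] at e0 e1 e2 e3
  have hi0 : iK ≠ 0 := fun h => by simpa [h] using iK_sq
  by_cases hA0 : A₀ = 0
  · subst hA0
    have hu := isUnit_of_ne_zero hi (hA.resolve_left (not_not.2 rfl))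
    simp only [map_zero, zero_mulVec, zero_add, add_zero, smul_eq_zero, hi0, false_or]
      at e0 e1 e2 e3
    exact hwne ⟨toMatrixHom_mulVec_eq_zero hu e1,
      toMatrixHom_mulVec_eq_zero (hu.map U) e2,
      toMatrixHom_mulVec_eq_zero ((hu.map U).map U) e3,
      toMatrixHom_mulVec_eq_zero (((hu.map U).map U).map U) e0⟩
  · obtain ⟨u, hu⟩ := isUnit_of_ne_zero hi hA0
    have hu' : IsUnit A₀ := ⟨u, hu⟩
    set C := A₁ * (↑u⁻¹ : CyclicAlgebra σ (-1 : F)) with hC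
    have hA1 : A₁ = C * A₀ := by rw [hC, mul_assoc, ← hu, Units.inv_mul, mul_one]
    simp only [hA1, map_mul, ← mulVec_mulVec] at e0 e1 e2 e3
    set w0 := toMatrixHom A₀ *ᵥ w 0
    set w1 := toMatrixHom (U A₀) *ᵥ w 1 with hw1
    set w2 := toMatrixHom (U (U A₀)) *ᵥ w 2 with hw2
    set w3 := toMatrixHom (U (U (U A₀))) *ᵥ w 3 with hw3
    have f1 := eq_neg_of_add_eq_zero_right e1
    have f2 := eq_neg_of_add_eq_zero_right e2
    have f3 := eq_neg_of_add_eq_zero_right e3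
    rw [f1, mulVec_neg, neg_neg] at f2
    rw [f2, mulVec_mulVec, mulVec_mulVec, ← map_mul, ← map_mul] at f3
    have hw0 : w0 ≠ 0 := by
      intro h0
      rw [h0, mulVec_zero, neg_zero] at f1 f3
      rw [h0, mulVec_zero, mulVec_zero] at f2
      exact hwne ⟨toMatrixHom_mulVec_eq_zero hu' h0,
        toMatrixHom_mulVec_eq_zero (hu'.map U) f1,
        toMatrixHom_mulVec_eq_zero ((hu'.map U).map U) f2,
        toMatrixHom_mulVec_eq_zero (((hu'.map U).map U).map U) f3⟩
    have key : toMatrixHom (U (U (U C)) * (U (U C) * U C * C)) *ᵥ w0 = -(iK • w0) := by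
      rw [map_mul, ← mulVec_mulVec]
      have f0 := eq_neg_of_add_eq_zero_left e0
      rw [f3, mulVec_neg, smul_neg, neg_neg] at f0
      have h := congrArg (iK • ·) f0
      simp only [smul_smul, ← pow_two, iK_sq, neg_smul, one_smul] at h
      rw [h, neg_neg]
    have hinv : ∀ A, upsilonHom hi τ⁻¹ (U A) = A := fun A =>
      CyclicAlgebra.ext (τ.symm_apply_apply _) (τ.symm_apply_apply _)
    apply mul_upsilonHom_sq_ne_neg_one hi τ⁻¹ (U (U (U C)))
    rw [hinv, hinv, hinv, mul_assoc, mul_assoc, ← mul_assoc (U (U C))]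
    exact sq_eq_neg_one_of_mulVec hi hw0 key

/-- Applying `τ` to all entries of the block matrix shifts the blocks along the diagonal, which
is also the effect of conjugation by a monomial matrix. -/
theorem galL_det_blockMatrix (τ : K ≃ₐ[L] K) (A₀ A₁ : CyclicAlgebra σ (-1 : F)) :
    τ (comp _ _ _ _ _ (blockMatrix hi τ A₀ A₁)).det =
      (comp _ _ _ _ _ (blockMatrix hi τ A₀ A₁)).det := by
  let P : Matrix (Fin 4) (Fin 4) (Matrix (Fin 2) (Fin 2) K) :=
    !![0, 1, 0, 0; 0, 0, 1, 0; 0, 0, 0, 1; -(iK • 1), 0, 0, 0]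
  let Q : Matrix (Fin 4) (Fin 4) (Matrix (Fin 2) (Fin 2) K) :=
    !![0, 0, 0, iK • 1; 1, 0, 0, 0; 0, 1, 0, 0; 0, 0, 1, 0]
  have hsq : iK * iK = -1 := by rw [← pow_two, iK_sq]
  have hPQ : P * Q = 1 := by
    ext1 k l
    fin_cases k <;> fin_cases l <;>
      simp [P, Q, Matrix.mul_apply, Fin.sum_univ_four, smul_smul, hsq]
  have hcomm : (blockMatrix hi τ A₀ A₁).map (fun X => X.map τ) * P =
      P * blockMatrix hi τ A₀ A₁ := by
    have hs : ∀ X : Matrix (Fin 2) (Fin 2) K, (iK • X).map τ = iK • X.map τ := fun X => by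
      ext1 i j
      simp [galL_iK]
    have hz : (0 : Matrix (Fin 2) (Fin 2) K).map τ = 0 := by ext1 i j; simp
    ext1 k l
    fin_cases k <;> fin_cases l <;>
      simp [P, blockMatrix, Matrix.mul_apply, Fin.sum_univ_four, smul_smul, hsq, hs, hz,
        map_toMatrixHom hi, upsilonHom_four]
  have hc : ∀ X Y : Matrix (Fin 4) (Fin 4) (Matrix (Fin 2) (Fin 2) K),
      comp _ _ _ _ _ (X * Y) = comp _ _ _ _ _ X * comp _ _ _ _ _ Y :=
    fun X Y => map_mul (compRingEquiv (Fin 4) (Fin 2) K) X Y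
  have h1 : comp _ _ _ _ _ (1 : Matrix (Fin 4) (Fin 4) (Matrix (Fin 2) (Fin 2) K)) = 1 :=
    map_one (compRingEquiv (Fin 4) (Fin 2) K)
  have hP0 : (comp _ _ _ _ _ P).det ≠ 0 := by
    intro h
    have h2 := congrArg (fun X => (comp _ _ _ _ _ X).det) hPQ
    simp [hc, h1, h] at h2
  apply mul_right_cancel₀ hP0
  have h3 : τ (comp _ _ _ _ _ (blockMatrix hi τ A₀ A₁)).det =
      (comp _ _ _ _ _ ((blockMatrix hi τ A₀ A₁).map (fun X => X.map τ))).det :=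
    RingHom.map_det (τ : K →+* K) _
  rw [h3, ← det_mul, ← hc, hcomm, hc, det_mul, mul_comm]

theorem blockMatrix_sub (τ : K ≃ₐ[L] K) (A₀ A₁ B₀ B₁ : CyclicAlgebra σ (-1 : F)) :
    blockMatrix hi τ A₀ A₁ - blockMatrix hi τ B₀ B₁ =
      blockMatrix hi τ (A₀ - B₀) (A₁ - B₁) := by
  ext1 k l
  fin_cases k <;> fin_cases l <;> simp [blockMatrix, smul_sub]

theorem isIntegral_det_blockMatrix (τ : K ≃ₐ[L] K) {A₀ A₁ : CyclicAlgebra σ (-1 : F)}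
    (h0 : IsIntegral ℤ A₀.fst ∧ IsIntegral ℤ A₀.snd)
    (h1 : IsIntegral ℤ A₁.fst ∧ IsIntegral ℤ A₁.snd) :
    IsIntegral ℤ (comp _ _ _ _ _ (blockMatrix hi τ A₀ A₁)).det := by
  have hU : ∀ A : CyclicAlgebra σ (-1 : F), IsIntegral ℤ A.fst ∧ IsIntegral ℤ A.snd →
      IsIntegral ℤ (upsilonHom hi τ A).fst ∧ IsIntegral ℤ (upsilonHom hi τ A).snd :=
    fun A hA => ⟨map_isIntegral_int (τ : K →+* K) hA.1, map_isIntegral_int (τ : K →+* K) hA.2⟩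
  have hM : ∀ A : CyclicAlgebra σ (-1 : F), IsIntegral ℤ A.fst ∧ IsIntegral ℤ A.snd →
      ∀ i j, IsIntegral ℤ (toMatrixHom A i j) := by
    intro A hA i j
    have ha : IsIntegral ℤ (σ A.fst) := map_isIntegral_int (σ : K →+* K) hA.1
    have hb : IsIntegral ℤ (σ A.snd) := map_isIntegral_int (σ : K →+* K) hA.2
    fin_cases i <;> fin_cases j <;>
      simp [toMatrixHom_apply, CyclicAlgebra.toMatrix, ha, hb.neg, hA.1, hA.2]
  have hentry : ∀ k l i j, IsIntegral ℤ (blockMatrix hi τ A₀ A₁ k l i j) := by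
    intro k l i j
    have hz : IsIntegral ℤ ((0 : Matrix (Fin 2) (Fin 2) K) i j) := isIntegral_zero
    have hs := isIntegral_iK.mul (hM _ (hU _ (hU _ (hU _ h1))) i j)
    fin_cases k <;> fin_cases l
    exacts [hM _ h0 i j, hz, hz, hs, hM _ h1 i j, hM _ (hU _ h0) i j, hz, hz,
      hz, hM _ (hU _ h1) i j, hM _ (hU _ (hU _ h0)) i j, hz,
      hz, hz, hM _ (hU _ (hU _ h1)) i j, hM _ (hU _ (hU _ (hU _ h0))) i j]
  rw [det_apply]
  refine IsIntegral.sum _ fun p _ => ?_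
  rw [Units.smul_def]
  exact (IsIntegral.prod _ fun x _ => hentry _ _ _ _).smul _

end Block

end MIDO

namespace MIDO

open Polynomial IntermediateField Matrix

/-! ### Gaussian integers and the symbol basis -/

theorem mem_range_of_mem_L {x : K} (hx : x ∈ L) : ∃ p q : ℚ, x = (p : K) + q * iK := by
  have h : x ∈ Algebra.adjoin ℚ {iK} := by
    rwa [← adjoin_simple_toSubalgebra_of_isAlgebraic (Algebra.IsAlgebraic.isAlgebraic iK)]
  clear hx
  induction h using Algebra.adjoin_induction with
  | mem x hx =>
    obtain rfl : x = iK := hx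
    exact ⟨0, 1, by simp⟩
  | algebraMap r => exact ⟨r, 0, by simp⟩
  | add x y _ _ hx hy =>
    obtain ⟨p, q, rfl⟩ := hx
    obtain ⟨p', q', rfl⟩ := hy
    exact ⟨p + p', q + q', by push_cast; ring⟩
  | mul x y _ _ hx hy =>
    obtain ⟨p, q, rfl⟩ := hx
    obtain ⟨p', q', rfl⟩ := hy
    refine ⟨p * p' - q * q', p * q' + q * p', ?_⟩
    push_cast
    linear_combination (q : K) * q' * iK_sq

theorem mem_L_of_fixed {τ : K ≃ₐ[L] K} (hτ : Subgroup.zpowers τ = ⊤) {x : K} (hx : τ x = x) :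
    x ∈ L := by
  have h : x ∈ Set.range (algebraMap L K) := by
    rw [IsGalois.mem_range_algebraMap_iff_fixed]
    intro g
    have hg : g ∈ Subgroup.zpowers τ := hτ ▸ Subgroup.mem_top g
    have hle : Subgroup.zpowers τ ≤ MulAction.stabilizer (K ≃ₐ[L] K) x := by
      rw [Subgroup.zpowers_le]
      exact hx
    exact hle hg
  obtain ⟨y, rfl⟩ := h
  exact y.2

/-- A nonzero algebraic integer of `ℚ(i)` is a Gaussian integer, of norm at least one. -/
theorem one_le_norm_sq {σ : K ≃ₐ[F] K} (hi : σ iK = -iK) {x : K} (hx : x ∈ L)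
    (hint : IsIntegral ℤ x) (hx0 : x ≠ 0) : 1 ≤ ‖(x : ℂ)‖ ^ 2 := by
  obtain ⟨p, q, rfl⟩ := mem_range_of_mem_L hx
  set x : K := (p : K) + q * iK with hxdef
  have h1 : algebraMap ℚ K (p ^ 2 + q ^ 2) = x * σ x := by
    rw [hxdef]
    simp only [map_add, map_mul, map_pow, eq_ratCast, hi, map_ratCast]
    linear_combination (q : K) ^ 2 * iK_sq
  have h2 : IsIntegral ℤ (p ^ 2 + q ^ 2) := by
    rw [← isIntegral_algebraMap_iff (algebraMap ℚ K).injective, h1]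
    exact hint.mul (map_isIntegral_int (σ : K →+* K) hint)
  obtain ⟨n, hn⟩ := IsIntegrallyClosed.isIntegral_iff.1 h2
  have h3 : ((‖(x : ℂ)‖ ^ 2 : ℝ) : ℂ) = (n : ℝ) := by
    have h4 := congrArg (algebraMap K ℂ) h1
    rw [← hn, map_mul] at h4
    rw [← Complex.normSq_eq_norm_sq, ← Complex.mul_conj, ← coe_galF hi]
    exact h4.symm.trans (by simp)
  have h5 := Complex.ofReal_injective h3
  rw [h5]
  have h6 : 0 < ‖(x : ℂ)‖ ^ 2 := by
    have : (x : ℂ) ≠ 0 := fun h => hx0 (Subtype.ext h)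
    positivity
  rw [h5] at h6
  exact_mod_cast h6

theorem gaussToK_sub (z w : GaussianInt) : gaussToK (z - w) = gaussToK z - gaussToK w := by
  simp only [gaussToK, Zsqrtd.re_sub, Zsqrtd.im_sub]
  push_cast
  ring

theorem gaussToK_mem_L (z : GaussianInt) : gaussToK z ∈ L :=
  add_mem (intCast_mem _ _) (mul_mem (intCast_mem _ _) (mem_adjoin_simple_self ℚ iK))

theorem isIntegral_gaussToK (z : GaussianInt) : IsIntegral ℤ (gaussToK z) :=
  (isIntegral_algebraMap (x := z.re)).add ((isIntegral_algebraMap (x := z.im)).mul isIntegral_iK)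

theorem eq_zero_of_gaussToK_eq_zero {z : GaussianInt} (h : gaussToK z = 0) : z = 0 := by
  have h1 := congrArg (algebraMap K ℂ) h
  simp only [gaussToK, map_add, map_mul, map_intCast, map_zero,
    show algebraMap K ℂ iK = Complex.I from rfl] at h1
  exact GaussianInt.toComplex_eq_zero.1 ((GaussianInt.toComplex_def z).trans h1)

/-- The element `α = 1 + i (θ² - 3)` has real part one. -/
theorem alpha_ne_zero : alpha ≠ 0 := by
  intro h
  have h1 := congrArg (algebraMap K ℂ) h
  have h2 := congrArg (starRingEnd ℂ) h1
  have ht : starRingEnd ℂ (algebraMap K ℂ thetaK) = algebraMap K ℂ thetaK := star_thetaK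
  simp only [alpha, map_add, map_sub, map_mul, map_pow, map_one, map_ofNat, map_zero, ht,
    show algebraMap K ℂ iK = Complex.I from rfl, Complex.conj_I] at h1 h2
  have h3 : (2 : ℂ) = 0 := by linear_combination h1 + h2
  norm_num at h3

theorem coeff_eq_zero_of_natDegree_minpoly {k E : Type*} [Field k] [Field E] [Algebra k E] {x : E}
    (hx : (minpoly k x).natDegree = 4) {a b c d : k}
    (h : algebraMap k E a + algebraMap k E b * x + algebraMap k E c * x ^ 2 +
      algebraMap k E d * x ^ 3 = 0) : a = 0 ∧ b = 0 ∧ c = 0 ∧ d = 0 := by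
  let p : k[X] := C a + C b * X + C c * X ^ 2 + C d * X ^ 3
  have hp : aeval x p = 0 := by simpa [p] using h
  have hp0 : p = 0 := by
    by_contra hp0
    have h1 := natDegree_le_of_dvd (minpoly.dvd k x hp) hp0
    have h2 : p.natDegree ≤ 3 := by
      simp only [p]
      compute_degree
    omega
  have hcoeff : ∀ n, p.coeff n = 0 := fun n => by rw [hp0, coeff_zero]
  have h0 := hcoeff 0
  have h1 := hcoeff 1
  have h2 := hcoeff 2
  have h3 := hcoeff 3
  simp [p, coeff_X, coeff_C] at h0 h1 h2 h3
  exact ⟨h0, h1, h2, h3⟩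

/-- The powers `1, θ, θ², θ³` are linearly independent over `L`. -/
theorem coeff_eq_zero {a b c d : K} (ha : a ∈ L) (hb : b ∈ L) (hc : c ∈ L) (hd : d ∈ L)
    (h : a + b * thetaK + c * thetaK ^ 2 + d * thetaK ^ 3 = 0) :
    a = 0 ∧ b = 0 ∧ c = 0 ∧ d = 0 := by
  have h4 : (minpoly L thetaK).natDegree = 4 := by
    rw [minpoly_L_thetaK]
    compute_degree!
  obtain ⟨h0, h1, h2, h3⟩ := coeff_eq_zero_of_natDegree_minpoly (a := (⟨a, ha⟩ : L))
    (b := ⟨b, hb⟩) (c := ⟨c, hc⟩) (d := ⟨d, hd⟩) h4 h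
  exact ⟨congrArg Subtype.val h0, congrArg Subtype.val h1, congrArg Subtype.val h2,
    congrArg Subtype.val h3⟩

/-- The symbol basis `θ₁, …, θ₄` is linearly independent over `ℚ(i)`. -/
theorem eq_zero_of_sum_thetaBasis {s : Fin 4 → GaussianInt}
    (h : ∑ i, gaussToK (s i) * thetaBasis i = 0) : s = 0 := by
  rw [Fin.sum_univ_four] at h
  change gaussToK (s 0) * alpha + gaussToK (s 1) * (alpha * thetaK) +
    gaussToK (s 2) * (alpha * thetaK * (-3 + thetaK ^ 2)) +
    gaussToK (s 3) * (alpha * (-1 - 3 * thetaK + thetaK ^ 2 + thetaK ^ 3)) = 0 at h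
  have hL := fun i => gaussToK_mem_L (s i)
  have h3L : (3 : K) ∈ L := ofNat_mem L 3
  have h1 : (gaussToK (s 0) - gaussToK (s 3)) +
      (gaussToK (s 1) - 3 * gaussToK (s 2) - 3 * gaussToK (s 3)) * thetaK +
      gaussToK (s 3) * thetaK ^ 2 + (gaussToK (s 2) + gaussToK (s 3)) * thetaK ^ 3 = 0 := by
    apply mul_left_cancel₀ alpha_ne_zero
    linear_combination h
  obtain ⟨e0, e1, e2, e3⟩ := coeff_eq_zero (sub_mem (hL 0) (hL 3))
    (sub_mem (sub_mem (hL 1) (mul_mem h3L (hL 2))) (mul_mem h3L (hL 3))) (hL 3)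
    (add_mem (hL 2) (hL 3)) h1
  rw [e2] at e0 e1 e3
  rw [add_zero] at e3
  rw [e3] at e1
  simp only [mul_zero, sub_zero] at e0 e1
  funext i
  fin_cases i
  exacts [eq_zero_of_gaussToK_eq_zero e0, eq_zero_of_gaussToK_eq_zero e1,
    eq_zero_of_gaussToK_eq_zero e3, eq_zero_of_gaussToK_eq_zero e2]

theorem isIntegral_thetaBasis (i : Fin 4) : IsIntegral ℤ (thetaBasis i) := by
  have h3 : IsIntegral ℤ (3 : K) := isIntegral_algebraMap (R := ℤ) (x := 3)
  have ht := isIntegral_thetaK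
  have ha : IsIntegral ℤ alpha :=
    (isIntegral_one.sub (h3.mul isIntegral_iK)).add (isIntegral_iK.mul (ht.pow 2))
  fin_cases i
  · exact ha
  · exact ha.mul ht
  · exact (ha.mul ht).mul (h3.neg.add (ht.pow 2))
  · exact ha.mul (((isIntegral_one.neg.sub (h3.mul ht)).add (ht.pow 2)).add (ht.pow 3))

/-! ### The code -/

section Code

variable {σ : K ≃ₐ[F] K}

theorem isIntegral_layer (s : Fin 2 × Fin 8 → GaussianInt) (k : Fin 2) :
    IsIntegral ℤ (layer σ s k).fst ∧ IsIntegral ℤ (layer σ s k).snd := by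
  constructor <;> dsimp only [layer] <;>
    exact IsIntegral.sum _ fun i _ => (isIntegral_gaussToK _).mul (isIntegral_thetaBasis i)

theorem layer_ne_zero {s : Fin 2 × Fin 8 → GaussianInt} (hs : s ≠ 0) :
    layer σ s 0 ≠ 0 ∨ layer σ s 1 ≠ 0 := by
  by_contra! h
  have hk : ∀ k, layer σ s k = 0 := by
    intro k
    fin_cases k
    exacts [h.1, h.2]
  apply hs
  funext ⟨k, j⟩
  have h1 := eq_zero_of_sum_thetaBasis (s := fun i => s (k, Fin.castAdd 4 i))
    (congrArg CyclicAlgebra.fst (hk k))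
  have h2 := eq_zero_of_sum_thetaBasis (s := fun i => s (k, Fin.natAdd 4 i))
    (congrArg CyclicAlgebra.snd (hk k))
  refine Fin.addCases (m := 4) (n := 4) (motive := fun j => s (k, j) = 0) ?_ ?_ j
  · exact fun i => congrFun h1 i
  · exact fun i => congrFun h2 i

variable [hσ : Fact (∀ x, σ (σ x) = x)] (hi : σ iK = -iK)

theorem layer_sub (s t : Fin 2 × Fin 8 → GaussianInt) (k : Fin 2) :
    layer σ (s - t) k = layer σ s k - layer σ t k := by
  rw [eq_sub_iff_add_eq]
  refine CyclicAlgebra.ext ?_ ?_ <;>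
    simp [layer, gaussToK_sub, sub_mul, Finset.sum_sub_distrib]

include hi

theorem codeword_sub (τ : K ≃ₐ[L] K) (s t : Fin 2 × Fin 8 → GaussianInt) :
    codeword σ τ s - codeword σ τ t = codeword σ τ (s - t) := by
  have h : codewordK σ τ s - codewordK σ τ t = codewordK σ τ (s - t) := by
    rw [codewordK_eq hi, codewordK_eq hi, codewordK_eq hi, layer_sub, layer_sub,
      ← blockMatrix_sub hi]
    rfl
  rw [codeword, codeword, codeword, ← h]
  ext i j
  simp

omit hσ hi in
theorem det_codeword (τ : K ≃ₐ[L] K) (s : Fin 2 × Fin 8 → GaussianInt) :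
    (codeword σ τ s).det = ((codewordK σ τ s).det : K) :=
  (RingHom.map_det (algebraMap K ℂ) (codewordK σ τ s)).symm

theorem det_codewordK_ne_zero (τ : K ≃ₐ[L] K) {s : Fin 2 × Fin 8 → GaussianInt} (hs : s ≠ 0) :
    (codewordK σ τ s).det ≠ 0 := by
  rw [codewordK_eq hi]
  exact det_blockMatrix_ne_zero hi τ (layer_ne_zero hs)

theorem det_codeword_ne_zero (τ : K ≃ₐ[L] K) {s : Fin 2 × Fin 8 → GaussianInt} (hs : s ≠ 0) :
    (codeword σ τ s).det ≠ 0 := by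
  rw [det_codeword]
  exact fun h => det_codewordK_ne_zero hi τ hs (Subtype.ext h)

theorem fullDiversity (τ : K ≃ₐ[L] K) (S : Set GaussianInt) :
    FullDiversity (codeword σ τ) S := by
  intro s t _ _ hst
  rw [codeword_sub hi]
  exact det_codeword_ne_zero hi τ (sub_ne_zero.2 hst)

/-- The determinant of a nonzero codeword is a nonzero Gaussian integer. -/
theorem one_le_norm_det {τ : K ≃ₐ[L] K} (hτ : Subgroup.zpowers τ = ⊤)
    {s : Fin 2 × Fin 8 → GaussianInt} (hs : s ≠ 0) : 1 ≤ ‖(codeword σ τ s).det‖ ^ 2 := by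
  rw [det_codeword]
  refine one_le_norm_sq hi (mem_L_of_fixed hτ ?_) ?_ (det_codewordK_ne_zero hi τ hs)
  · rw [codewordK_eq hi]
    exact galL_det_blockMatrix hi τ _ _
  · rw [codewordK_eq hi]
    exact isIntegral_det_blockMatrix hi τ (isIntegral_layer s 0) (isIntegral_layer s 1)

theorem nvd {τ : K ≃ₐ[L] K} (hτ : Subgroup.zpowers τ = ⊤) : NVD (codeword σ τ) := by
  refine lt_of_lt_of_le one_pos (le_csInf ?_ ?_)
  · refine ⟨_, 1, fun h => ?_, rfl⟩
    exact det_codeword_ne_zero hi τ (s := 1) one_ne_zero (by rw [h, det_zero])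
  · rintro d ⟨s, hs, rfl⟩
    refine one_le_norm_det hi hτ ?_
    rintro rfl
    exact hs (by simpa using (codeword_sub hi τ 0 0).symm)

end Code

end MIDO

theorem mainTheorem7 :
    (IsGalois MIDO.L MIDO.K ∧ IsCyclic (MIDO.K ≃ₐ[MIDO.L] MIDO.K) ∧
      Nat.card (MIDO.K ≃ₐ[MIDO.L] MIDO.K) = 4) ∧
    (IsGalois MIDO.F MIDO.K ∧ IsCyclic (MIDO.K ≃ₐ[MIDO.F] MIDO.K) ∧
      Nat.card (MIDO.K ≃ₐ[MIDO.F] MIDO.K) = 2) ∧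
    ∀ (σ : MIDO.K ≃ₐ[MIDO.F] MIDO.K) (τ : MIDO.K ≃ₐ[MIDO.L] MIDO.K),
      Subgroup.zpowers σ = ⊤ → Subgroup.zpowers τ = ⊤ →
      (∀ A : CyclicAlgebra σ (-1 : MIDO.F),
        A * A.upsilon τ * (A.upsilon τ).upsilon τ * ((A.upsilon τ).upsilon τ).upsilon τ ≠
          CyclicAlgebra.ofField MIDO.iK) ∧
      (∀ a : ℕ, Even a → 0 < a →
        MIDO.FullDiversity (MIDO.codeword σ τ) (MIDO.QAM (2 ^ a))) ∧
      MIDO.NVD (MIDO.codeword σ τ) := by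
  refine ⟨⟨MIDO.isGalois_L, MIDO.isCyclic_galL, MIDO.card_galL⟩,
    ⟨MIDO.isGalois_F, MIDO.isCyclic_galF, MIDO.card_galF⟩, fun σ τ hσ hτ => ?_⟩
  have hi := MIDO.galF_iK hσ
  have : Fact (∀ x, σ (σ x) = x) := ⟨MIDO.galF_galF hi⟩
  exact ⟨MIDO.mul_upsilonHom_ne_iK hi τ, fun _ _ _ => MIDO.fullDiversity hi τ _, MIDO.nvd hi hτ⟩
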